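/- A composition is a finite (possibly empty) list $\alpha=(\alpha_1,\dots,\alpha_\ell)$ of positive integers; $\ell(\alpha)=\ell$ is its length and $|\alpha|=\alpha_1+\cdots+\alpha_\ell$. Let $$M_\alpha=\sum_{i_1<\cdots<i_\ell}x_{i_1}^{\alpha_1}\cdots x_{i_\ell}^{\alpha_\ell}\in\mathbb{C}[[x_1,x_2,\dots]]$$ be the monomial quasisymmetric function ($M_{()}=1$), and let $\mathrm{QSym}$ be the $\mathbb{C}$-span of all the $M_\alpha$, which are linearly independent. It is a Hopf algebra with the product of formal power series, the coproduct $\Delta(M_\alpha)=\sum_{\beta\gamma=\alpha}M_\beta\otimes M_\gamma$ (the sum over all ways of writing $\alpha$ as a concatenation), and the constant term as counit; let $\mathcal{S}$ be its antipode. Put $I(\alpha)=\{\alpha_1,\alpha_1+\alpha_2,\dots,\alpha_1+\cdots+\alpha_{\ell-1}\}$ and, for compositions with $|\alpha|=|\beta|$, write $\beta\le\alpha$ if $I(\beta)\subseteq I(\alpha)$. Let $m_o(\alpha)$ be the composition obtained from $\alpha$ by cutting it after each position $i<\ell$ with $\alpha_i$ odd and $\alpha_{i+1}$ even, and adding up the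 parts within each of the resulting segments. If $\beta\le\alpha$, then each part $\beta_i$ is a sum of consecutive parts of $\alpha$; let $\mathrm{O}_\alpha^\beta(i)$ and $\mathrm{E}_\alpha^\beta(i)$ be the numbers of odd and of even parts among them, and put $c_\alpha^\beta=\prod_i \frac{1}{\mathrm{O}_\alpha^\beta(i)!\,\mathrm{E}_\alpha^\beta(i)!}$. The elements of the shuffle basis of $\mathrm{QSym}$ are $$S_\alpha=\sum_{m_o(\alpha)\le\beta\le\alpha}c_\alpha^\beta M_\beta .$$ Then, for every composition $\alpha=(\alpha_1,\dots,\alpha_\ell)$, $$\mathcal{S}(S_\alpha)=(-1)^{\ell}\,S_{(\alpha_\ell,\dots,\alpha_1)} .$$ -/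

import Mathlib

noncomputable section

open scoped TensorProduct

/-- A composition: a finite list of positive integers. -/
abbrev Comp : Type := List ℕ+

namespace Comp

/-- The integer `|α| = α₁ + ⋯ + α_ℓ` of which `α` is a composition. -/
def size (α : Comp) : ℕ := (α.map (fun a : ℕ+ => (a : ℕ))).sum

end Comp

namespace QuasiSymm

/-- The monomial quasisymmetric function
`M_α = ∑_{i₁ < ⋯ < i_ℓ} x_{i₁}^{α₁} ⋯ x_{i_ℓ}^{α_ℓ}`, as a formal power series over `ℂ` in the
commuting variables `x₀, x₁, x₂, …`. Since the parts of `α` are positive, distinct index sequences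
give distinct monomials, so each monomial that occurs has coefficient `1`. -/
def monomialSeries (α : Comp) : MvPowerSeries ℕ ℂ := by
  classical
  exact fun m => if ∃ i : Fin α.length → ℕ, StrictMono i ∧
    m = ∑ j, Finsupp.single (i j) (α.get j : ℕ) then 1 else 0

/-! ### Products of monomial quasisymmetric functions -/

/-- `m` is a monomial of `M_α` that only involves variables `x_i` with `k ≤ i`. -/
def IsTerm (k : ℕ) (α : Comp) (m : ℕ →₀ ℕ) : Prop :=
  ∃ i : Fin α.length → ℕ, StrictMono i ∧ (∀ j, k ≤ i j) ∧
    m = ∑ j, Finsupp.single (i j) (α.get j : ℕ)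

lemma IsTerm.eq_zero {k : ℕ} {α : Comp} {m : ℕ →₀ ℕ} (h : IsTerm k α m) {j : ℕ} (hj : j < k) :
    m j = 0 := by
  obtain ⟨i, -, hk, rfl⟩ := h
  rw [Finsupp.finsetSum_apply]
  refine Finset.sum_eq_zero fun x _ => ?_
  rw [Finsupp.single_apply, if_neg]
  have := hk x
  omega

lemma isTerm_nil {k : ℕ} {m : ℕ →₀ ℕ} : IsTerm k [] m ↔ m = 0 := by
  constructor
  · rintro ⟨i, -, -, rfl⟩
    rfl
  · rintro rfl
    exact ⟨fun j => j.elim0, fun j => j.elim0, fun j => j.elim0, rfl⟩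

lemma isTerm_cons {k : ℕ} {a : ℕ+} {u : Comp} {m : ℕ →₀ ℕ} :
    IsTerm k (a :: u) m ↔ IsTerm (k + 1) (a :: u) m ∨
      ∃ m', m = Finsupp.single k (a : ℕ) + m' ∧ IsTerm (k + 1) u m' := by
  constructor
  · rintro ⟨i, hi, hk, rfl⟩
    have hk0 := hk ⟨0, by simp⟩
    have hmono : ∀ j : Fin u.length, i ⟨0, by simp⟩ < i (Fin.succ j) := fun j =>
      hi (by simp [Fin.lt_def])
    rcases hk0.eq_or_lt with h | h
    · right
      refine ⟨∑ j : Fin u.length, Finsupp.single (i (Fin.succ j)) (u.get j : ℕ), ?_,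
        fun j => i (Fin.succ j), ?_, ?_, rfl⟩
      · erw [Fin.sum_univ_succ]
        congr 1
        rw [h]; rfl
      · intro x y hxy
        exact hi (Fin.succ_lt_succ_iff.mpr hxy)
      · intro j
        have := hmono j
        show k + 1 ≤ i (Fin.succ j)
        omega
    · left
      refine ⟨i, hi, fun j => ?_, rfl⟩
      have : i ⟨0, by simp⟩ ≤ i j := hi.monotone (by simp)
      omega
  · rintro (⟨i, hi, hk, rfl⟩ | ⟨m', rfl, i, hi, hk, rfl⟩)
    · exact ⟨i, hi, fun j => (Nat.le_succ k).trans (hk j), rfl⟩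
    · refine ⟨Fin.cons (α := fun _ => ℕ) k i, ?_, ?_, ?_⟩
      · intro x y hxy
        induction y using Fin.cases with
        | zero => simp at hxy
        | succ y =>
          induction x using Fin.cases with
          | zero => simp only [Fin.cons_zero, Fin.cons_succ]; exact hk y
          | succ x => simpa using hi (by simpa using hxy)
      · intro j
        induction j using Fin.cases with
        | zero => simp
        | succ j => simp only [Fin.cons_succ]; exact (Nat.le_succ k).trans (hk j)
      · erw [Fin.sum_univ_succ]
        simp

/-- The part of `M_α` in the variables `x_i` with `k ≤ i`. -/
def tailSeries (k : ℕ) (α : Comp) : MvPowerSeries ℕ ℂ := by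
  classical
  exact fun m => if IsTerm k α m then 1 else 0

open Classical in
lemma coeff_tailSeries (k : ℕ) (α : Comp) (m : ℕ →₀ ℕ) :
    MvPowerSeries.coeff m (tailSeries k α) = if IsTerm k α m then 1 else 0 := by
  show tailSeries k α m = _
  rw [tailSeries]

lemma tailSeries_zero (α : Comp) : tailSeries 0 α = monomialSeries α := by
  ext m
  show tailSeries 0 α m = monomialSeries α m
  have h : IsTerm 0 α m ↔ ∃ i : Fin α.length → ℕ, StrictMono i ∧
      m = ∑ j, Finsupp.single (i j) (α.get j : ℕ) := by
    simp only [IsTerm, Nat.zero_le, implies_true, true_and]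
  rw [tailSeries, monomialSeries]
  classical exact if_congr h rfl rfl

lemma tailSeries_nil (k : ℕ) : tailSeries k [] = 1 := by
  classical
  ext m
  rw [coeff_tailSeries, MvPowerSeries.coeff_one]
  simp only [isTerm_nil]

lemma tailSeries_cons (k : ℕ) (a : ℕ+) (u : Comp) :
    tailSeries k (a :: u) = tailSeries (k + 1) (a :: u) +
      MvPowerSeries.monomial (Finsupp.single k (a : ℕ)) 1 * tailSeries (k + 1) u := by
  classical
  ext m
  rw [map_add, MvPowerSeries.coeff_monomial_mul, coeff_tailSeries, coeff_tailSeries,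
    coeff_tailSeries, isTerm_cons]
  by_cases h : Finsupp.single k (a : ℕ) ≤ m
  · obtain ⟨m', rfl⟩ := exists_add_of_le h
    have h1 : ¬ IsTerm (k + 1) (a :: u) (Finsupp.single k (a : ℕ) + m') := by
      intro h
      have := h.eq_zero (Nat.lt_succ_self k)
      simp at this
    simp [h1]
  · have h2 : ¬ ∃ m', m = Finsupp.single k (a : ℕ) + m' ∧ IsTerm (k + 1) u m' := by
      rintro ⟨m', rfl, -⟩
      exact h (le_add_of_nonneg_right zero_le)
    simp [h, h2]

/-- The quasi-shuffle of two compositions, as a list with multiplicities. -/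
def quasiShuffle : Comp → Comp → List Comp
  | [], v => [v]
  | a :: u, [] => [a :: u]
  | a :: u, b :: v =>
    (quasiShuffle u (b :: v)).map (List.cons a) ++
      ((quasiShuffle (a :: u) v).map (List.cons b) ++
        (quasiShuffle u v).map (List.cons (a + b)))
  termination_by u v => u.length + v.length

/-- Power series all of whose monomials involve a variable `x_i` with `N ≤ i`. -/
def Negligible (N : ℕ) (f : MvPowerSeries ℕ ℂ) : Prop :=
  ∀ m : ℕ →₀ ℕ, (∀ j, N ≤ j → m j = 0) → MvPowerSeries.coeff m f = 0

lemma Negligible.add {N : ℕ} {f g : MvPowerSeries ℕ ℂ} (hf : Negligible N f)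
    (hg : Negligible N g) : Negligible N (f + g) := fun m hm => by
  rw [map_add, hf m hm, hg m hm, add_zero]

lemma Negligible.monomial_mul {N : ℕ} {f : MvPowerSeries ℕ ℂ} (hf : Negligible N f)
    (n : ℕ →₀ ℕ) : Negligible N (MvPowerSeries.monomial n 1 * f) := fun m hm => by
  classical
  rw [MvPowerSeries.coeff_monomial_mul]
  split_ifs
  · rw [hf, mul_zero]
    intro j hj
    simp [hm j hj]
  · rfl

lemma negligible_tailSeries_cons (N : ℕ) (a : ℕ+) (u : Comp) :
    Negligible N (tailSeries N (a :: u)) := fun m hm => by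
  classical
  rw [coeff_tailSeries, if_neg]
  intro h
  have h0 : m = 0 := by
    ext j
    rcases lt_or_ge j N with hj | hj
    · exact h.eq_zero hj
    · exact hm j hj
  subst h0
  obtain ⟨i, -, -, h⟩ := h
  have := DFunLike.congr_fun h (i ⟨0, by simp⟩)
  rw [Finsupp.finsetSum_apply] at this
  simp only [Finsupp.coe_zero, Pi.zero_apply] at this
  have h3 := (Finset.sum_eq_zero_iff.mp this.symm) ⟨0, by simp⟩ (Finset.mem_univ _)
  simp at h3

lemma Negligible.mul_right {N : ℕ} {f : MvPowerSeries ℕ ℂ} (hf : Negligible N f)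
    (g : MvPowerSeries ℕ ℂ) : Negligible N (f * g) := fun m hm => by
  classical
  rw [MvPowerSeries.coeff_mul]
  refine Finset.sum_eq_zero fun p hp => ?_
  rw [hf, zero_mul]
  intro j hj
  have := DFunLike.congr_fun (Finset.HasAntidiagonal.mem_antidiagonal.mp hp) j
  simp [hm j hj] at this
  exact this.1

lemma Negligible.sub {N : ℕ} {f g : MvPowerSeries ℕ ℂ} (hf : Negligible N f)
    (hg : Negligible N g) : Negligible N (f - g) := fun m hm => by
  rw [map_sub, hf m hm, hg m hm, sub_zero]

lemma negligible_sum {N : ℕ} (L : List (MvPowerSeries ℕ ℂ)) (h : ∀ f ∈ L, Negligible N f) :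
    Negligible N L.sum := by
  induction L with
  | nil => intro m _; simp
  | cons f L ih =>
    rw [List.sum_cons]
    exact (h f (by simp)).add (ih fun g hg => h g (by simp [hg]))

lemma sum_map_tailSeries_cons (k : ℕ) (c : ℕ+) (L : List Comp) :
    ((L.map (List.cons c)).map (tailSeries k)).sum =
      ((L.map (List.cons c)).map (tailSeries (k + 1))).sum +
        MvPowerSeries.monomial (Finsupp.single k (c : ℕ)) 1 *
          (L.map (tailSeries (k + 1))).sum := by
  induction L with
  | nil => simp
  | cons w L ih =>
    simp only [List.map_cons, List.sum_cons] at ih ⊢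
    rw [ih, tailSeries_cons]
    ring

lemma negligible_quasiShuffle (N : ℕ) (d : ℕ) : ∀ k, N = k + d → ∀ u v : Comp,
    Negligible N (tailSeries k u * tailSeries k v -
      ((quasiShuffle u v).map (tailSeries k)).sum) := by
  have hz : Negligible N 0 := fun m _ => by simp
  induction d with
  | zero =>
    rintro k rfl u v
    cases u with
    | nil => simpa [quasiShuffle, tailSeries_nil] using hz
    | cons a u =>
      cases v with
      | nil => simpa [quasiShuffle, tailSeries_nil] using hz
      | cons b v =>
        refine ((negligible_tailSeries_cons _ _ _).mul_right _).sub (negligible_sum _ ?_)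
        intro f hf
        simp only [quasiShuffle, List.map_append, List.mem_append, List.mem_map] at hf
        rcases hf with ⟨_, ⟨w, -, rfl⟩, rfl⟩ | ⟨_, ⟨w, -, rfl⟩, rfl⟩ | ⟨_, ⟨w, -, rfl⟩, rfl⟩ <;>
        exact negligible_tailSeries_cons _ _ _
  | succ d ih =>
    rintro k rfl u v
    cases u with
    | nil => simpa [quasiShuffle, tailSeries_nil] using hz
    | cons a u =>
      cases v with
      | nil => simpa [quasiShuffle, tailSeries_nil] using hz
      | cons b v =>
        have ih' := ih (k + 1) (by omega)
        have e1 := ih' (a :: u) (b :: v)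
        have e2 := (ih' u (b :: v)).monomial_mul (Finsupp.single k (a : ℕ))
        have e3 := (ih' (a :: u) v).monomial_mul (Finsupp.single k (b : ℕ))
        have e4 := (ih' u v).monomial_mul (Finsupp.single k ((a + b : ℕ+) : ℕ))
        have key := ((e1.add e2).add e3).add e4
        convert key using 1
        have hm : MvPowerSeries.monomial (R := ℂ) (Finsupp.single k ((a + b : ℕ+) : ℕ)) 1 =
            MvPowerSeries.monomial (Finsupp.single k (a : ℕ)) 1 *
              MvPowerSeries.monomial (Finsupp.single k (b : ℕ)) 1 := by
          rw [MvPowerSeries.monomial_mul_monomial, ← Finsupp.single_add, PNat.add_coe, one_mul]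
        rw [tailSeries_cons k a u, tailSeries_cons k b v]
        simp only [quasiShuffle, List.map_append, List.sum_append]
        rw [sum_map_tailSeries_cons k a, sum_map_tailSeries_cons k b,
          sum_map_tailSeries_cons k (a + b), hm]
        ring

lemma monomialSeries_mul (u v : Comp) :
    monomialSeries u * monomialSeries v = ((quasiShuffle u v).map monomialSeries).sum := by
  have h : monomialSeries u * monomialSeries v - ((quasiShuffle u v).map monomialSeries).sum = 0 := by
    ext m
    have := negligible_quasiShuffle (m.support.sup id + 1) (m.support.sup id + 1) 0 (by omega) u v m
      (fun j hj => by
        by_contra hne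
        have : j ≤ m.support.sup id :=
          Finset.le_sup (f := id) (Finsupp.mem_support_iff.mpr hne)
        omega)
    have e : (tailSeries 0 : Comp → _) = monomialSeries := funext tailSeries_zero
    simpa [e] using this
  exact sub_eq_zero.mp h

/-! ### Linear independence -/

/-- The exponent vector of `x_k^{β₁} x_{k+1}^{β₂} ⋯`. -/
def packed : ℕ → Comp → (ℕ →₀ ℕ)
  | _, [] => 0
  | k, b :: v => Finsupp.single k (b : ℕ) + packed (k + 1) v

lemma packed_eq_zero (β : Comp) : ∀ {k j : ℕ}, j < k → packed k β j = 0 := by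
  induction β with
  | nil => intros; rfl
  | cons b v ih =>
    intro k j h
    rw [packed, Finsupp.add_apply, ih (by omega), Finsupp.single_apply, if_neg (by omega)]

lemma isTerm_packed (α : Comp) : ∀ (β : Comp) (k : ℕ), IsTerm k α (packed k β) ↔ α = β := by
  induction α with
  | nil =>
    intro β k
    rw [isTerm_nil]
    cases β with
    | nil => simp [packed]
    | cons b v =>
      simp only [packed, reduceCtorEq, iff_false]
      intro h
      have := DFunLike.congr_fun h k
      simp at this
  | cons a u ih =>
    intro β k
    rw [isTerm_cons]
    cases β with
    | nil =>
      simp only [packed, reduceCtorEq, iff_false, not_or]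
      constructor
      · rintro ⟨i, -, -, h⟩
        have := DFunLike.congr_fun h (i ⟨0, by simp⟩)
        rw [Finsupp.finsetSum_apply] at this
        simp only [Finsupp.coe_zero, Pi.zero_apply] at this
        have h3 := (Finset.sum_eq_zero_iff.mp this.symm) ⟨0, by simp⟩ (Finset.mem_univ _)
        simp at h3
      · rintro ⟨m', h, -⟩
        have := DFunLike.congr_fun h k
        simp only [Finsupp.coe_zero, Pi.zero_apply, Finsupp.add_apply,
          Finsupp.single_eq_same] at this
        have := a.pos
        omega
    | cons b v =>
      have h1 : ¬ IsTerm (k + 1) (a :: u) (packed k (b :: v)) := by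
        intro h
        have := h.eq_zero (Nat.lt_succ_self k)
        simp [packed] at this
      rw [or_iff_right h1]
      constructor
      · rintro ⟨m', h, hm'⟩
        have hk := DFunLike.congr_fun h k
        simp only [packed, Finsupp.add_apply, Finsupp.single_eq_same, hm'.eq_zero (Nat.lt_succ_self k),
          packed_eq_zero v (Nat.lt_succ_self k), add_zero] at hk
        have hab : b = a := PNat.coe_injective hk
        subst hab
        rw [packed, add_right_inj] at h
        subst h
        rw [(ih v (k + 1)).mp hm']
      · rintro h
        obtain ⟨rfl, rfl⟩ := List.cons.inj h
        exact ⟨_, rfl, (ih _ _).mpr rfl⟩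

lemma linearIndependent_monomialSeries : LinearIndependent ℂ monomialSeries := by
  classical
  rw [linearIndependent_iff]
  intro l hl
  ext β
  have h := congrArg (MvPowerSeries.coeff (packed 0 β)) hl
  rw [Finsupp.linearCombination_apply, Finsupp.sum, map_sum] at h
  simp only [map_smul, ← tailSeries_zero, coeff_tailSeries, isTerm_packed] at h
  simpa using h

/-! ### The Hopf algebra of quasisymmetric functions -/

lemma monomialSeries_nil : monomialSeries [] = 1 := by
  rw [← tailSeries_zero, tailSeries_nil]

end QuasiSymm

open QuasiSymm

/-- The algebra `QSym` of quasisymmetric functions over `ℂ`: the span of the monomial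
quasisymmetric functions, with the product of formal power series. -/
def QSym : Subalgebra ℂ (MvPowerSeries ℕ ℂ) :=
  (Submodule.span ℂ (Set.range monomialSeries)).toSubalgebra
    (Submodule.subset_span ⟨[], monomialSeries_nil⟩)
    (by
      intro f g hf hg
      have h := Submodule.mul_mem_mul hf hg
      rw [Submodule.span_mul_span] at h
      refine (Submodule.span_le.mpr ?_) h
      rintro _ ⟨_, ⟨u, rfl⟩, _, ⟨v, rfl⟩, rfl⟩
      show monomialSeries u * monomialSeries v ∈ Submodule.span ℂ (Set.range monomialSeries)
      rw [monomialSeries_mul]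
      refine list_sum_mem ?_
      intro f hf
      obtain ⟨w, -, rfl⟩ := List.mem_map.mp hf
      exact Submodule.subset_span ⟨w, rfl⟩)

namespace QSym

/-- The basis of `QSym` formed by the monomial quasisymmetric functions `M_α`. -/
def M : Module.Basis Comp ℂ QSym :=
  Module.Basis.span linearIndependent_monomialSeries

@[simp]
lemma coe_M (α : Comp) : (M α : MvPowerSeries ℕ ℂ) = monomialSeries α :=
  congrArg Subtype.val (Module.Basis.span_apply linearIndependent_monomialSeries α)

lemma M_nil : M [] = 1 := Subtype.ext (by rw [coe_M, monomialSeries_nil]; rfl)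

lemma M_mul (u v : Comp) : M u * M v = ((quasiShuffle u v).map M).sum := by
  apply Subtype.ext
  rw [MulMemClass.coe_mul, coe_M, coe_M, monomialSeries_mul]
  generalize quasiShuffle u v = L
  induction L with
  | nil => rfl
  | cons w L ih => simp only [List.map_cons, List.sum_cons, ih, AddMemClass.coe_add, coe_M]

/-- The coproduct of `QSym`, by deconcatenation: `Δ(M_α) = ∑_{βγ = α} M_β ⊗ M_γ`. -/
def comulMap : QSym →ₗ[ℂ] QSym ⊗[ℂ] QSym :=
  M.constr ℂ fun α => ∑ k ∈ Finset.range (α.length + 1), M (α.take k) ⊗ₜ[ℂ] M (α.drop k)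

/-- The counit of `QSym`, which takes the constant term of a power series. -/
def counitMap : QSym →ₐ[ℂ] ℂ where
  toFun f := MvPowerSeries.constantCoeff (f : MvPowerSeries ℕ ℂ)
  map_one' := by simp
  map_mul' := by simp
  map_zero' := by simp
  map_add' := by simp
  commutes' r := by
    show MvPowerSeries.constantCoeff (algebraMap ℂ (MvPowerSeries ℕ ℂ) r) = r
    rw [MvPowerSeries.algebraMap_apply]
    simp

lemma comulMap_M (α : Comp) : comulMap (M α) =
    ∑ k ∈ Finset.range (α.length + 1), M (α.take k) ⊗ₜ[ℂ] M (α.drop k) :=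
  M.constr_basis ℂ _ α

lemma counitMap_M_cons (a : ℕ+) (u : Comp) : counitMap (M (a :: u)) = 0 := by
  show MvPowerSeries.constantCoeff (M (a :: u) : MvPowerSeries ℕ ℂ) = 0
  rw [coe_M, ← tailSeries_zero]
  exact negligible_tailSeries_cons 0 a u 0 (fun _ _ => rfl)

/-- The linear map `M_u ↦ M_{au}`. -/
def prepend (a : ℕ+) : QSym →ₗ[ℂ] QSym := M.constr ℂ fun u => M (a :: u)

lemma prepend_M (a : ℕ+) (u : Comp) : prepend a (M u) = M (a :: u) := M.constr_basis ℂ _ u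

lemma comulMap_M_cons (a : ℕ+) (u : Comp) : comulMap (M (a :: u)) =
    1 ⊗ₜ M (a :: u) + (prepend a).rTensor QSym (comulMap (M u)) := by
  rw [comulMap_M, comulMap_M, List.length_cons, Finset.sum_range_succ', add_comm, map_sum]
  simp [prepend_M, M_nil]

lemma comulMap_prepend (a : ℕ+) (x : QSym) : comulMap (prepend a x) =
    1 ⊗ₜ prepend a x + (prepend a).rTensor QSym (comulMap x) := by
  have : comulMap ∘ₗ prepend a = TensorProduct.mk ℂ QSym QSym 1 ∘ₗ prepend a +
      (prepend a).rTensor QSym ∘ₗ comulMap := by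
    refine M.ext fun u => ?_
    simp [prepend_M, comulMap_M_cons]
  exact LinearMap.congr_fun this x

lemma comulMap_one : comulMap 1 = 1 := by
  rw [← M_nil, comulMap_M]
  simp [M_nil, Algebra.TensorProduct.one_def]

lemma comulMap_coassoc : TensorProduct.assoc ℂ QSym QSym QSym ∘ₗ comulMap.rTensor QSym ∘ₗ
    comulMap = comulMap.lTensor QSym ∘ₗ comulMap := by
  refine M.ext fun α => ?_
  induction α with
  | nil =>
    rw [M_nil]
    simp [comulMap_one, Algebra.TensorProduct.one_def]
  | cons a u ih =>
    simp only [LinearMap.comp_apply, LinearEquiv.coe_coe] at ih ⊢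
    rw [comulMap_M_cons]
    have key : ∀ x : QSym ⊗[ℂ] QSym,
        TensorProduct.assoc ℂ QSym QSym QSym (comulMap.rTensor QSym
          ((prepend a).rTensor QSym x)) = 1 ⊗ₜ (prepend a).rTensor QSym x +
        (prepend a).rTensor (QSym ⊗[ℂ] QSym)
          (TensorProduct.assoc ℂ QSym QSym QSym (comulMap.rTensor QSym x)) := by
      intro x
      induction x with
      | zero => simp
      | add x y hx hy => simp only [map_add, hx, hy, TensorProduct.tmul_add]; abel
      | tmul x y =>
        simp only [LinearMap.rTensor_tmul, comulMap_prepend, TensorProduct.add_tmul, map_add,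
          TensorProduct.assoc_tmul]
        congr 1
        generalize comulMap x = z
        induction z with
        | zero => simp
        | add z w hz hw => simp only [map_add, hz, hw, TensorProduct.add_tmul]
        | tmul z w => simp
    have comm : ∀ x : QSym ⊗[ℂ] QSym, comulMap.lTensor QSym ((prepend a).rTensor QSym x) =
        (prepend a).rTensor (QSym ⊗[ℂ] QSym) (comulMap.lTensor QSym x) := by
      intro x
      induction x with
      | zero => simp
      | add x y hx hy => simp only [map_add, hx, hy]
      | tmul x y => simp
    rw [map_add, map_add, map_add, key, comm, ← ih]
    simp only [LinearMap.rTensor_tmul, LinearMap.lTensor_tmul, comulMap_one,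
      Algebra.TensorProduct.one_def, TensorProduct.assoc_tmul, comulMap_M_cons,
      TensorProduct.tmul_add]
    abel

instance : Coalgebra ℂ QSym where
  comul := comulMap
  counit := counitMap.toLinearMap
  coassoc := comulMap_coassoc
  rTensor_counit_comp_comul := by
    refine M.ext fun α => ?_
    cases α with
    | nil => simp [M_nil, comulMap_one, Algebra.TensorProduct.one_def]
    | cons a u =>
      have h : ∀ x : QSym ⊗[ℂ] QSym, counitMap.toLinearMap.rTensor QSym
          ((prepend a).rTensor QSym x) = 0 := by
        have h0 : counitMap.toLinearMap ∘ₗ prepend a = 0 :=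
          M.ext fun u => by simp [prepend_M, counitMap_M_cons]
        intro x
        rw [← LinearMap.comp_apply, ← LinearMap.rTensor_comp, h0]
        simp
      simp only [LinearMap.comp_apply]
      rw [comulMap_M_cons, map_add, h]
      simp
  lTensor_counit_comp_comul := by
    refine M.ext fun α => ?_
    simp only [LinearMap.comp_apply, TensorProduct.mk_apply, LinearMap.flip_apply]
    induction α with
    | nil => simp [M_nil, comulMap_one, Algebra.TensorProduct.one_def]
    | cons a u ih =>
      have h : ∀ x : QSym ⊗[ℂ] QSym, counitMap.toLinearMap.lTensor QSym
          ((prepend a).rTensor QSym x) =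
          (prepend a).rTensor ℂ (counitMap.toLinearMap.lTensor QSym x) := by
        intro x
        induction x with
        | zero => simp
        | add x y hx hy => simp only [map_add, hx, hy]
        | tmul x y => simp
      rw [comulMap_M_cons, map_add, h, ih]
      simp [counitMap_M_cons, prepend_M]

lemma prepend_sum (c : ℕ+) (L : List Comp) :
    ((L.map (List.cons c)).map M).sum = prepend c ((L.map M).sum) := by
  induction L with
  | nil => simp
  | cons w L ih =>
    simp only [List.map_cons, List.sum_cons, map_add, prepend_M, ih]

lemma prepend_mul_prepend (a b : ℕ+) (x y : QSym) : prepend a x * prepend b y =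
    prepend a (x * prepend b y) + prepend b (prepend a x * y) + prepend (a + b) (x * y) := by
  have h : (LinearMap.mul ℂ QSym).compl₁₂ (prepend a) (prepend b) =
      ((LinearMap.mul ℂ QSym).compl₁₂ LinearMap.id (prepend b)).compr₂ (prepend a) +
      ((LinearMap.mul ℂ QSym).compl₁₂ (prepend a) LinearMap.id).compr₂ (prepend b) +
      (LinearMap.mul ℂ QSym).compr₂ (prepend (a + b)) := by
    refine M.ext fun u => M.ext fun v => ?_
    simp only [LinearMap.compl₁₂_apply, LinearMap.add_apply, LinearMap.compr₂_apply,
      LinearMap.mul_apply', LinearMap.id_apply, prepend_M, M_mul, quasiShuffle, List.map_append,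
      List.sum_append, prepend_sum, add_assoc]
  exact LinearMap.congr_fun (LinearMap.congr_fun h x) y

lemma rTensor_prepend_mul (a b : ℕ+) (x y : QSym ⊗[ℂ] QSym) :
    (prepend a).rTensor QSym x * (prepend b).rTensor QSym y =
      (prepend a).rTensor QSym (x * (prepend b).rTensor QSym y) +
      (prepend b).rTensor QSym ((prepend a).rTensor QSym x * y) +
      (prepend (a + b)).rTensor QSym (x * y) := by
  induction x with
  | zero => simp
  | add x x' hx hx' => simp only [map_add, add_mul, hx, hx']; abel
  | tmul x x' =>
    induction y with
    | zero => simp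
    | add y y' hy hy' => simp only [map_add, mul_add, hy, hy']; abel
    | tmul y y' =>
      simp only [LinearMap.rTensor_tmul, Algebra.TensorProduct.tmul_mul_tmul, prepend_mul_prepend,
        TensorProduct.add_tmul]

lemma one_tmul_mul_rTensor_prepend (b : ℕ+) (w : QSym) (y : QSym ⊗[ℂ] QSym) :
    (1 ⊗ₜ w) * (prepend b).rTensor QSym y = (prepend b).rTensor QSym ((1 ⊗ₜ w) * y) := by
  induction y with
  | zero => simp
  | add y y' hy hy' => simp only [map_add, mul_add, hy, hy']
  | tmul y y' => simp

lemma comulMap_M_mul (n : ℕ) : ∀ u v : Comp, u.length + v.length = n →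
    comulMap (M u * M v) = comulMap (M u) * comulMap (M v) := by
  induction n using Nat.strong_induction_on with
  | _ n ih =>
    intro u v hn
    cases u with
    | nil => simp [M_nil, comulMap_one]
    | cons a u =>
      cases v with
      | nil => simp [M_nil, comulMap_one]
      | cons b v =>
        simp only [List.length_cons] at hn
        have h1 := ih (u.length + (b :: v).length) (by simp; omega) u (b :: v) rfl
        have h2 := ih ((a :: u).length + v.length) (by simp; omega) (a :: u) v rfl
        have h3 := ih (u.length + v.length) (by omega) u v rfl
        have hp := prepend_mul_prepend a b (M u) (M v)
        rw [prepend_M, prepend_M] at hp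
        have hL : comulMap (M (a :: u) * M (b :: v)) = 1 ⊗ₜ (M (a :: u) * M (b :: v)) +
            ((prepend a).rTensor QSym (comulMap (M u) * comulMap (M (b :: v))) +
            (prepend b).rTensor QSym (comulMap (M (a :: u)) * comulMap (M v)) +
            (prepend (a + b)).rTensor QSym (comulMap (M u) * comulMap (M v))) := by
          rw [hp, map_add, map_add, comulMap_prepend, comulMap_prepend, comulMap_prepend, h1, h2,
            h3, TensorProduct.tmul_add, TensorProduct.tmul_add]
          abel
        rw [hL, comulMap_M_cons a u, comulMap_M_cons b v]
        simp only [mul_add, add_mul, map_add]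
        rw [rTensor_prepend_mul, one_tmul_mul_rTensor_prepend,
          mul_comm ((prepend a).rTensor QSym (comulMap (M u))) (1 ⊗ₜ[ℂ] M (b :: v)),
          one_tmul_mul_rTensor_prepend, mul_comm (comulMap (M u)) (1 ⊗ₜ[ℂ] M (b :: v)),
          Algebra.TensorProduct.tmul_mul_tmul, one_mul]
        abel

lemma comulMap_mul (x y : QSym) : comulMap (x * y) = comulMap x * comulMap y := by
  have h : (LinearMap.mul ℂ QSym).compr₂ comulMap =
      (LinearMap.mul ℂ (QSym ⊗[ℂ] QSym)).compl₁₂ comulMap comulMap := by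
    refine M.ext fun u => M.ext fun v => ?_
    simpa using comulMap_M_mul _ u v rfl
  exact LinearMap.congr_fun (LinearMap.congr_fun h x) y

instance : Bialgebra ℂ QSym :=
  Bialgebra.mk' ℂ QSym (map_one counitMap) (fun {a b} => map_mul counitMap a b) comulMap_one
    (fun {a b} => comulMap_mul a b)

/-! ### The antipode

It is the convolution inverse of the identity, which the geometric series
`∑_k (η ∘ ε - id)^{*k}` computes; the sum is finite on each `M_α`. -/

open WithConv in
/-- The map `η ∘ ε - id`, in the convolution algebra of endomorphisms of `QSym`. -/
def reduced : WithConv (QSym →ₗ[ℂ] QSym) := 1 - toConv LinearMap.id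

open WithConv in
lemma one_sub_reduced : 1 - reduced = toConv LinearMap.id :=
  WithConv.ext (LinearMap.ext fun x =>
    show (1 : WithConv (QSym →ₗ[ℂ] QSym)).ofConv x -
      ((1 : WithConv (QSym →ₗ[ℂ] QSym)).ofConv x - x) = x from sub_sub_cancel _ _)

lemma reduced_one : reduced.ofConv 1 = 0 := by
  show algebraMap ℂ QSym (counitMap 1) - 1 = 0
  simp

lemma convMul_M (f g : WithConv (QSym →ₗ[ℂ] QSym)) (α : Comp) :
    (f * g).ofConv (M α) = ∑ k ∈ Finset.range (α.length + 1),
      f.ofConv (M (α.take k)) * g.ofConv (M (α.drop k)) := by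
  show LinearMap.mul' ℂ QSym (TensorProduct.map f.ofConv g.ofConv (comulMap (M α))) = _
  rw [comulMap_M, map_sum, map_sum]
  simp

lemma reduced_pow_M (n : ℕ) : ∀ α : Comp, α.length < n → (reduced ^ n).ofConv (M α) = 0 := by
  induction n with
  | zero => intro α h; omega
  | succ n ih =>
    intro α h
    rw [pow_succ', convMul_M]
    refine Finset.sum_eq_zero fun k hk => ?_
    rcases Nat.eq_zero_or_pos k with rfl | hk0
    · rw [List.take_zero, M_nil, reduced_one, zero_mul]
    · rw [Finset.mem_range] at hk
      rw [ih, mul_zero]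
      rw [List.length_drop]
      omega

/-- The partial sums of the geometric series. -/
def geomSum (n : ℕ) : WithConv (QSym →ₗ[ℂ] QSym) := ∑ k ∈ Finset.range n, reduced ^ k

lemma geomSum_M {n : ℕ} {α : Comp} (h : α.length < n) :
    (geomSum n).ofConv (M α) = (geomSum (α.length + 1)).ofConv (M α) := by
  induction n with
  | zero => omega
  | succ n ih =>
    rcases (Nat.lt_succ_iff.mp h).eq_or_lt with h' | h'
    · rw [h']
    · rw [← ih h', geomSum, Finset.sum_range_succ, WithConv.ofConv_add, LinearMap.add_apply,
        reduced_pow_M n α h', add_zero]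
      rfl

/-- The antipode of `QSym`. -/
def antipodeMap : QSym →ₗ[ℂ] QSym :=
  M.constr ℂ fun α => (geomSum (α.length + 1)).ofConv (M α)

lemma antipodeMap_M {n : ℕ} {α : Comp} (h : α.length < n) :
    antipodeMap (M α) = (geomSum n).ofConv (M α) := by
  rw [geomSum_M h]
  exact M.constr_basis ℂ _ α

open WithConv in
instance : HopfAlgebra ℂ QSym :=
  HopfAlgebra.ofConvInverse antipodeMap
    (by
      refine WithConv.ext (M.ext fun α => ?_)
      have h := geom_sum_mul_neg reduced (α.length + 1)
      have h' := congrArg (fun f : WithConv (QSym →ₗ[ℂ] QSym) => f.ofConv (M α)) h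
      have h2 : 1 - reduced = toConv LinearMap.id := one_sub_reduced
      simp only [h2, WithConv.ofConv_sub, LinearMap.sub_apply,
        reduced_pow_M _ α (Nat.lt_succ_self _), sub_zero] at h'
      rw [← h', convMul_M, convMul_M]
      refine Finset.sum_congr rfl fun k _ => ?_
      rw [WithConv.ofConv_toConv, antipodeMap_M (n := α.length + 1)]
      · rfl
      · rw [List.length_take]; omega)
    (by
      refine WithConv.ext (M.ext fun α => ?_)
      have h := mul_neg_geom_sum reduced (α.length + 1)
      have h' := congrArg (fun f : WithConv (QSym →ₗ[ℂ] QSym) => f.ofConv (M α)) h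
      have h2 : 1 - reduced = toConv LinearMap.id := one_sub_reduced
      simp only [h2, WithConv.ofConv_sub, LinearMap.sub_apply,
        reduced_pow_M _ α (Nat.lt_succ_self _), sub_zero] at h'
      rw [← h', convMul_M, convMul_M]
      refine Finset.sum_congr rfl fun k _ => ?_
      rw [WithConv.ofConv_toConv antipodeMap, antipodeMap_M (n := α.length + 1)]
      · rfl
      · rw [List.length_drop]; omega)

end QSym

/-! ### The shuffle basis -/

namespace Comp

/-- The set `I(α) = {α₁, α₁ + α₂, …, α₁ + ⋯ + α_{ℓ-1}}`. -/
def partialSums (α : Comp) : Finset ℕ :=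
  (Finset.range (α.length - 1)).image fun k => size (α.take (k + 1))

/-- The relation `β ≤ α` (`α` refines `β`) on compositions of the same integer:
`I(β) ⊆ I(α)`. -/
def Coarsens (β α : Comp) : Prop :=
  β.size = α.size ∧ β.partialSums ⊆ α.partialSums

/-- The odd-min composition `m_o(α)`: add up all consecutive parts of `α` that are not separated
by a position `i` with `α_i` odd and `α_{i+1}` even. -/
def oddMin : Comp → Comp
  | [] => []
  | [a] => [a]
  | a :: b :: w =>
    if Odd (a : ℕ) ∧ Even (b : ℕ) then a :: oddMin (b :: w)
    else match oddMin (b :: w) with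
      | [] => [a]
      | c :: r => (a + c) :: r

/-- The positions `j` of the parts of `α` that are summands of the part of `β` at position `i`,
where `α` refines `β` (positions start at `0`): the partial sum `α₀ + ⋯ + α_j` exceeds
`β₀ + ⋯ + β_{i-1}` and is at most `β₀ + ⋯ + β_i`. -/
def block (α β : Comp) (i : ℕ) : Finset (Fin α.length) :=
  Finset.univ.filter fun j => size (β.take i) < size (α.take (j + 1)) ∧
    size (α.take (j + 1)) ≤ size (β.take (i + 1))

/-- The number of odd parts of `α` among the summands of the part of `β` at position `i`. -/
def oddCount (α β : Comp) (i : ℕ) : ℕ :=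
  ((block α β i).filter fun j => Odd (α.get j : ℕ)).card

/-- The number of even parts of `α` among the summands of the part of `β` at position `i`. -/
def evenCount (α β : Comp) (i : ℕ) : ℕ :=
  ((block α β i).filter fun j => Even (α.get j : ℕ)).card

/-- The coefficient `c_α^β = ∏_i 1 / (O_α^β(i)! E_α^β(i)!)`. -/
def coeff (α β : Comp) : ℂ :=
  ∏ i ∈ Finset.range β.length,
    1 / ((Nat.factorial (oddCount α β i) : ℂ) * (Nat.factorial (evenCount α β i) : ℂ))

lemma finite_size (n : ℕ) : {β : Comp | β.size = n}.Finite := by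
  induction n using Nat.strong_induction_on with
  | _ n ih =>
    have h : {β : Comp | β.size = n} ⊆ {[]} ∪ ⋃ a ∈ Set.Icc (1 : ℕ) n,
        (List.cons a.toPNat') '' {β : Comp | β.size = n - a} := by
      rintro (_ | ⟨a, u⟩) hβ
      · simp
      · right
        simp only [Set.mem_ofPred_eq, size, List.map_cons, List.sum_cons] at hβ
        simp only [Set.mem_iUnion]
        refine ⟨(a : ℕ), ⟨a.pos, by omega⟩, u, ?_, by simp⟩
        simp only [Set.mem_ofPred_eq, size]
        omega
    refine ((Set.finite_singleton _).union
      ((Set.finite_Icc 1 n).biUnion fun a ha => (ih (n - a) ?_).image _)).subset h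
    have := ha.1
    have := ha.2
    omega

/-- The finite set of compositions `β` with `m_o(α) ≤ β ≤ α`. -/
def interval (α : Comp) : Finset Comp :=
  Set.Finite.toFinset (s := {β : Comp | Coarsens (oddMin α) β ∧ Coarsens β α})
    ((finite_size α.size).subset fun _ h => h.2.1)

end Comp

/-- The shuffle function `S_α = ∑_{m_o(α) ≤ β ≤ α} c_α^β M_β`. -/
def QSym.S (α : Comp) : QSym := ∑ β ∈ Comp.interval α, Comp.coeff α β • QSym.M β

end

/-! Words in the positive integers form a coalgebra under deconcatenation. A function `f` on words
with value 1 at the empty word induces a coalgebra morphism `blockSum f` to `QSym`: cut the word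
into blocks in all ways, multiply the values of `f` on the blocks, and take `M` of the block sums.

The condition m_o(α) ≤ β ≤ α says that β arises by cutting α into blocks in which no odd part is
directly followed by an even one, that is, blocks of even parts followed by odd parts. Hence S_α is
`blockSum weight α` (`S_eq_blockSum`), where `weight` is a convolution E * O: here E and O are
supported on the all-even and the all-odd words, with value 1/n! in length n (`weight_eq`).

If u ↦ g(reverse of u) is a left convolution inverse of `f`, the antipode sends `blockSum f w` to
`blockSum g w.reverse` (`antipode_blockSum`). By the antipode axiom and induction on length, this
amounts to the vanishing of the sum, over all cuts w = uv, of `blockSum g u.reverse * blockSum f v`.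
Expanding each product by the quasi-shuffle recursion and collecting terms leaves coefficients that
are values of the convolution of the two weights on nonempty segments of w, and these are zero
(`sum_mul_eq_zero_of_inverse_weights`).

Since (1 - 1)^n = 0 for n > 0, the inverses of E and O are their twists by (-1)^length. The inverse
of E * O is thus the twist of O * E, and reversal turns this into the twist of E * O. So g is
(-1)^length times `weight`, and the sign factors out of the block sum. -/

namespace Comp

noncomputable section

open scoped Nat

/-! ### Convolution of functions on words -/

/-- The convolution of functions on words with respect to deconcatenation. -/
def conv {A : Type*} (f g : List A → ℂ) : List A → ℂ
  | [] => f [] * g []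
  | a :: w => f [] * g (a :: w) + conv (fun u => f (a :: u)) g w

variable {A : Type*}

lemma conv_eq_sum (f g : List A → ℂ) (w : List A) :
    conv f g w = ∑ k ∈ Finset.range (w.length + 1), f (w.take k) * g (w.drop k) := by
  induction w generalizing f with
  | nil => simp [conv]
  | cons a w ih =>
    rw [List.length_cons, Finset.sum_range_succ', conv, ih, add_comm]
    simp

lemma conv_add_left (f f' g : List A → ℂ) (w : List A) :
    conv (fun u => f u + f' u) g w = conv f g w + conv f' g w := by
  simp only [conv_eq_sum, add_mul, Finset.sum_add_distrib]

lemma conv_smul_left (c : ℂ) (f g : List A → ℂ) (w : List A) :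
    conv (fun u => c * f u) g w = c * conv f g w := by
  simp only [conv_eq_sum, mul_assoc, Finset.mul_sum]

/-- Induction on the word works for all `f` and `g` at once, because shifting a convolution by a
letter again gives convolutions, with shifted arguments. -/
lemma conv_assoc (f g h : List A → ℂ) (w : List A) :
    conv (conv f g) h w = conv f (conv g h) w := by
  induction w generalizing f g with
  | nil => simp [conv, mul_assoc]
  | cons a w ih =>
    have e : (fun u => conv f g (a :: u)) =
        fun u => f [] * g (a :: u) + conv (fun v => f (a :: v)) g u := rfl
    rw [conv, e, conv_add_left, conv_smul_left, ih]
    simp only [conv]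
    ring

/-- The unit for convolution. -/
def convOne : List A → ℂ
  | [] => 1
  | _ :: _ => 0

lemma convOne_conv (g : List A → ℂ) : conv convOne g = g := by
  ext w
  cases w with
  | nil => simp [conv, convOne]
  | cons a w => simp [conv, convOne, conv_eq_sum]

/-- A cut of the reversed word is a cut of the word with the two pieces exchanged, so reversal is an
anti-automorphism of convolution. -/
lemma conv_reverse (f g : List A → ℂ) (w : List A) :
    conv f g w.reverse = conv (fun u => g u.reverse) (fun u => f u.reverse) w := by
  rw [conv_eq_sum, conv_eq_sum, List.length_reverse, ← Finset.sum_range_reflect]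
  refine Finset.sum_congr rfl fun k hk => ?_
  rw [Finset.mem_range] at hk
  rw [List.take_reverse, List.drop_reverse, mul_comm]
  congr <;> omega

/-- Lengths add under a cut, so the sign twist is an automorphism of convolution. -/
lemma conv_sign (f g : List A → ℂ) (w : List A) :
    conv (fun u => (-1) ^ u.length * f u) (fun u => (-1) ^ u.length * g u) w =
      (-1) ^ w.length * conv f g w := by
  rw [conv_eq_sum, conv_eq_sum, Finset.mul_sum]
  refine Finset.sum_congr rfl fun k _ => ?_
  have h : w.length = (w.take k).length + (w.drop k).length := by
    rw [← List.length_append, List.take_append_drop]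
  rw [h, pow_add]
  ring

/-- The exponential character supported on the words with all letters in `p`. -/
def expChar (p : A → Bool) (w : List A) : ℂ := if w.all p then 1 / (w.length ! : ℂ) else 0

lemma expChar_reverse (p : A → Bool) (w : List A) : expChar p w.reverse = expChar p w := by
  simp [expChar]

/-- The binomial expansion of (-1 + 1)^n, divided by n!. -/
lemma sum_alternating_inv_factorial {n : ℕ} (hn : n ≠ 0) :
    ∑ k ∈ Finset.range (n + 1), (-1 : ℂ) ^ k * (1 / (k ! : ℂ)) * (1 / ((n - k)! : ℂ)) = 0 := by
  have h := add_pow (-1 : ℂ) 1 n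
  rw [neg_add_cancel, zero_pow hn] at h
  have h2 : ∀ k ∈ Finset.range (n + 1), (-1 : ℂ) ^ k * (1 / (k ! : ℂ)) * (1 / ((n - k)! : ℂ)) =
      ((-1 : ℂ) ^ k * 1 ^ (n - k) * (n.choose k : ℂ)) * (1 / (n ! : ℂ)) := by
    intro k hk
    have hk' : k ≤ n := Nat.lt_succ_iff.mp (Finset.mem_range.mp hk)
    rw [Nat.cast_choose ℂ hk']
    have : (n ! : ℂ) ≠ 0 := Nat.cast_ne_zero.mpr n.factorial_ne_zero
    field_simp
    simp
  rw [Finset.sum_congr rfl h2, ← Finset.sum_mul, ← h, zero_mul]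

/-- A term survives only if all letters of the whole word satisfy `p`, a condition independent of
the cut; what remains is the alternating sum above. -/
lemma sign_expChar_conv_expChar (p : A → Bool) :
    conv (fun u => (-1) ^ u.length * expChar p u) (expChar p) = convOne := by
  ext w
  cases hw : w with
  | nil => simp [conv, expChar, convOne]
  | cons a v =>
    rw [← hw, conv_eq_sum]
    have hw0 : w.length ≠ 0 := by simp [hw]
    have h : ∀ k ∈ Finset.range (w.length + 1),
        ((-1) ^ (w.take k).length * expChar p (w.take k)) * expChar p (w.drop k) =
        (if w.all p then 1 else 0) *
          ((-1 : ℂ) ^ k * (1 / (k ! : ℂ)) * (1 / ((w.length - k)! : ℂ))) := by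
      intro k hk
      have hk' : k ≤ w.length := Nat.lt_succ_iff.mp (Finset.mem_range.mp hk)
      have e : w.all p = ((w.take k).all p && (w.drop k).all p) := by
        rw [← List.all_append, List.take_append_drop]
      rw [e, expChar, expChar, List.length_take, List.length_drop, min_eq_left hk']
      by_cases h1 : (w.take k).all p = true <;> by_cases h2 : (w.drop k).all p = true <;>
        simp only [h1, h2] <;> simp
    rw [Finset.sum_congr rfl h, ← Finset.mul_sum, sum_alternating_inv_factorial hw0, hw]
    simp [convOne]

/-! ### The weight of a block -/

/-- The character of the shuffle algebra that gives the coefficients of the shuffle basis. -/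
def weight : Comp → ℂ :=
  conv (expChar fun a : ℕ+ => decide (Even (a : ℕ))) (expChar fun a : ℕ+ => decide (Odd (a : ℕ)))

/-- The convolution inverse of `weight`, evaluated at the reversed word. -/
def signWeight (w : Comp) : ℂ := (-1) ^ w.length * weight w

lemma weight_nil : weight [] = 1 := by simp [weight, conv, expChar]

lemma signWeight_nil : signWeight [] = 1 := by simp [signWeight, weight_nil]

/-- With `weight` = E * O, reversal fixes E and O and exchanges the factors, so the left function is
O⁻¹ * E⁻¹, each inverse being a sign twist. The product then telescopes. -/
lemma signWeight_reverse_conv_weight :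
    conv (fun u : Comp => signWeight u.reverse) weight = convOne := by
  have h : (fun u : Comp => signWeight u.reverse) =
      conv (fun u => (-1) ^ u.length * expChar (fun a : ℕ+ => decide (Odd (a : ℕ))) u)
        (fun u => (-1) ^ u.length * expChar (fun a : ℕ+ => decide (Even (a : ℕ))) u) := by
    ext u
    rw [conv_sign, signWeight, List.length_reverse, weight, conv_reverse]
    simp only [expChar_reverse]
  ext w
  rw [h, conv_assoc]
  have h2 : conv (fun u => (-1) ^ u.length * expChar (fun a : ℕ+ => decide (Even (a : ℕ))) u)
      weight = expChar fun a : ℕ+ => decide (Odd (a : ℕ)) := by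
    ext w
    rw [weight, ← conv_assoc, sign_expChar_conv_expChar, convOne_conv]
  rw [h2, sign_expChar_conv_expChar]

/-- A word whose even letters all come before its odd letters. -/
def EvenOdd (w : Comp) : Prop := w.Pairwise fun a b : ℕ+ => Odd (a : ℕ) → Odd (b : ℕ)

-- Even and odd exclude each other, so an admissible cut can only lie between the last even and the
-- first odd letter: there is at most one.
open Classical in
lemma sum_split_evenOdd (w : Comp) :
    conv (fun u : Comp => if u.all (fun a : ℕ+ => decide (Even (a : ℕ))) then 1 else 0)
      (fun u : Comp => if u.all (fun a : ℕ+ => decide (Odd (a : ℕ))) then 1 else 0) w =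
    if EvenOdd w then 1 else 0 := by
  induction w with
  | nil => simp [conv, EvenOdd]
  | cons a w ih =>
    rw [conv]
    rcases Nat.even_or_odd (a : ℕ) with h | h
    · have h' : ¬ Odd (a : ℕ) := Nat.not_odd_iff_even.mpr h
      have e : EvenOdd (a :: w) ↔ EvenOdd w := by simp [EvenOdd, h']
      simp only [List.all_cons, h, h', decide_true, decide_false, Bool.true_and, Bool.false_and,
        ih, e]
      simp
    · have h' : ¬ Even (a : ℕ) := Nat.not_even_iff_odd.mpr h
      have e : EvenOdd (a :: w) ↔ ∀ b ∈ w, Odd (b : ℕ) := by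
        simp only [EvenOdd, List.pairwise_cons, h, true_imp_iff, and_iff_left_iff_imp]
        intro hb
        exact List.pairwise_of_forall_mem_list fun _ _ b hb' _ => hb b hb'
      simp only [List.all_cons, h, h', decide_true, decide_false, Bool.true_and, Bool.false_and]
      rw [conv_eq_sum]
      simp [e]

lemma countP_take_drop (p q : ℕ+ → Bool) (hpq : ∀ a, p a = !q a) (w : Comp) (k : ℕ)
    (h1 : (w.take k).all p) (h2 : (w.drop k).all q) :
    w.countP p = (w.take k).length ∧ w.countP q = (w.drop k).length := by
  have e := List.take_append_drop k w
  rw [List.all_eq_true] at h1 h2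
  constructor
  · conv_lhs => rw [← e]
    rw [List.countP_append, List.countP_eq_length.mpr h1, List.countP_eq_zero.mpr, add_zero]
    intro a ha
    simp [hpq, h2 a ha]
  · conv_lhs => rw [← e]
    rw [List.countP_append, List.countP_eq_length.mpr h2, List.countP_eq_zero.mpr, zero_add]
    intro a ha
    have := h1 a ha
    rw [hpq] at this
    simpa using this

-- At every admissible cut the two lengths are the numbers of even and of odd letters of the whole
-- word, so the factorials factor out of the convolution and a count of admissible cuts remains.
open Classical in
lemma weight_eq (w : Comp) : weight w = if EvenOdd w then
    1 / (((w.countP fun a : ℕ+ => decide (Odd (a : ℕ)))! : ℂ) *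
      ((w.countP fun a : ℕ+ => decide (Even (a : ℕ)))! : ℂ)) else 0 := by
  have h : weight w = (if EvenOdd w then 1 else 0) *
      (1 / (((w.countP fun a : ℕ+ => decide (Odd (a : ℕ)))! : ℂ) *
      ((w.countP fun a : ℕ+ => decide (Even (a : ℕ)))! : ℂ))) := by
    rw [← sum_split_evenOdd, weight, conv_eq_sum, conv_eq_sum, Finset.sum_mul]
    refine Finset.sum_congr rfl fun k _ => ?_
    rw [expChar, expChar]
    by_cases h1 : (w.take k).all (fun a : ℕ+ => decide (Even (a : ℕ))) = true
    · by_cases h2 : (w.drop k).all (fun a : ℕ+ => decide (Odd (a : ℕ))) = true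
      · obtain ⟨e1, e2⟩ := countP_take_drop _ _ (fun a => by simp [← Nat.not_odd_iff_even]) w k h1 h2
        rw [if_pos h1, if_pos h2, if_pos h1, if_pos h2, e1, e2]
        field_simp
      · rw [if_neg h2, if_neg h2]; simp
    · rw [if_neg h1, if_neg h1]; simp
  rw [h]
  split_ifs <;> simp

end

end Comp

noncomputable section

open scoped TensorProduct

/-! ### Cancellation of products in `QSym` built from mutually inverse weights. -/

namespace QSym

open Comp

/-- The linear map `M_u ↦ M_{nu}`, for a natural number `n` that is positive where it is used. -/
def prependNat (n : ℕ) : QSym →ₗ[ℂ] QSym := prepend n.toPNat'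

lemma prependNat_mul_prependNat {m n : ℕ} (hm : 0 < m) (hn : 0 < n) (x y : QSym) :
    prependNat m x * prependNat n y = prependNat m (x * prependNat n y) +
      prependNat n (prependNat m x * y) + prependNat (m + n) (x * y) := by
  have h : (m + n).toPNat' = m.toPNat' + n.toPNat' := by
    apply PNat.coe_injective
    rw [PNat.add_coe, Nat.toPNat'_coe, Nat.toPNat'_coe, Nat.toPNat'_coe, if_pos hm, if_pos hn,
      if_pos (by omega)]
  rw [prependNat, prependNat, prependNat, h]
  exact prepend_mul_prepend _ _ x y

lemma counitMap_prepend (a : ℕ+) (x : QSym) : counitMap (prepend a x) = 0 := by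
  have h0 : counitMap.toLinearMap ∘ₗ prepend a = 0 :=
    M.ext fun u => by simp [prepend_M, counitMap_M_cons]
  exact LinearMap.congr_fun h0 x

/-- If `x` and `y` are built up from the left and from the right with mutually inverse weights,
then the alternating products cancel. -/
lemma sum_mul_eq_zero_of_inverse_weights {n : ℕ} (hn : 0 < n) (s : ℕ → ℕ)
    (hs : ∀ i j, i < j → j ≤ n → s i < s j) (F G : ℕ → ℕ → ℂ)
    (hF : ∀ k, F k k = 1) (hG : ∀ k, G k k = 1)
    (hGF : ∀ i j, i < j → j ≤ n → ∑ k ∈ Finset.Icc i j, G i k * F k j = 0)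
    (x y : ℕ → QSym) (hx0 : x 0 = 1) (hyn : y n = 1)
    (hx : ∀ k, 0 < k → k ≤ n → x k = ∑ i ∈ Finset.range k, G i k • prependNat (s k - s i) (x i))
    (hy : ∀ k, k < n → y k = ∑ j ∈ Finset.Ioc k n, F k j • prependNat (s j - s k) (y j)) :
    ∑ k ∈ Finset.range (n + 1), x k * y k = 0 := by
  -- In `T i j k` the left factor has last block from i to k and the right factor has first block
  -- from k to j. The quasi-shuffle recursion yields the merged block (i < k < j), the left block
  -- alone (`T i k k`) and the right block alone (`T k j k`).
  let T (i j k : ℕ) : QSym := (G i k * F k j) • prependNat (s j - s i) (x i * y j)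
  have key : ∀ k ∈ Finset.range (n + 1), x k * y k =
      ∑ i ∈ Finset.range (k + 1), ∑ j ∈ Finset.Icc k n, if i < j then T i j k else 0 := by
    intro k hk
    have hkn : k ≤ n := Nat.lt_succ_iff.mp (Finset.mem_range.mp hk)
    have inner : ∀ i, ∑ j ∈ Finset.Icc k n, (if i < j then T i j k else 0) =
        (if i < k then T i k k else 0) +
          ∑ j ∈ Finset.Ioc k n, if i < j then T i j k else 0 := by
      intro i
      rw [← Finset.Ioc_insert_left hkn, Finset.sum_insert (by simp)]
    have e2 : ∀ i ≤ k, ∑ j ∈ Finset.Ioc k n, (if i < j then T i j k else 0) =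
        ∑ j ∈ Finset.Ioc k n, T i j k := by
      intro i hi
      refine Finset.sum_congr rfl fun j hj => ?_
      rw [Finset.mem_Ioc] at hj
      rw [if_pos (by omega)]
    have e3 : ∑ i ∈ Finset.range (k + 1), (if i < k then T i k k else 0) =
        ∑ i ∈ Finset.range k, T i k k := by
      rw [Finset.sum_range_succ, if_neg (lt_irrefl k), add_zero]
      exact Finset.sum_congr rfl fun i hi => if_pos (Finset.mem_range.mp hi)
    rw [Finset.sum_congr rfl fun i _ => inner i, Finset.sum_add_distrib, e3,
      Finset.sum_congr rfl fun i hi => e2 i (Nat.lt_succ_iff.mp (Finset.mem_range.mp hi)),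
      Finset.sum_range_succ]
    have a1 : 0 < k → ∑ i ∈ Finset.range k, T i k k =
        ∑ i ∈ Finset.range k, G i k • prependNat (s k - s i) (x i * y k) := by
      intro _
      simp only [T, hF, mul_one]
    have a2 : ∑ j ∈ Finset.Ioc k n, T k j k =
        ∑ j ∈ Finset.Ioc k n, F k j • prependNat (s j - s k) (x k * y j) := by
      simp only [T, hG, one_mul]
    -- At k = 0 and k = n one factor is 1 and has no block to remove, so only one of the three kinds
    -- of terms occurs.
    rcases Nat.eq_zero_or_pos k with rfl | hk0
    · rw [a2, hy 0 hn, hx0]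
      simp
    · rcases hkn.eq_or_lt with rfl | hkn'
      · rw [a1 hk0, hyn, hx k hk0 le_rfl]
        simp
      · have hterm : ∀ i ∈ Finset.range k, ∀ j ∈ Finset.Ioc k n,
            (G i k • prependNat (s k - s i) (x i)) * (F k j • prependNat (s j - s k) (y j)) =
            G i k • prependNat (s k - s i) (x i * (F k j • prependNat (s j - s k) (y j))) +
            F k j • prependNat (s j - s k) ((G i k • prependNat (s k - s i) (x i)) * y j) +
            T i j k := by
          intro i hi j hj
          rw [Finset.mem_range] at hi
          rw [Finset.mem_Ioc] at hj
          have h1 := hs i k hi hkn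
          have h2 := hs k j hj.1 hj.2
          have h3 : s j - s i = (s k - s i) + (s j - s k) := by omega
          simp only [T]
          rw [h3, smul_mul_smul_comm, prependNat_mul_prependNat (by omega) (by omega)]
          simp only [mul_smul_comm, smul_mul_assoc, map_smul, smul_add, smul_smul]
          rw [mul_comm (F k j) (G i k)]
        have hl : x k * y k = (∑ i ∈ Finset.range k, G i k • prependNat (s k - s i) (x i)) *
            ∑ j ∈ Finset.Ioc k n, F k j • prependNat (s j - s k) (y j) := by
          rw [← hx k hk0 hkn, ← hy k hkn']
        rw [hl, Finset.sum_mul_sum, Finset.sum_congr rfl fun i hi =>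
          Finset.sum_congr rfl fun j hj => hterm i hi j hj]
        simp only [Finset.sum_add_distrib]
        rw [a1 hk0, a2]
        have b1 : ∑ i ∈ Finset.range k, ∑ j ∈ Finset.Ioc k n,
            G i k • prependNat (s k - s i) (x i * F k j • prependNat (s j - s k) (y j)) =
            ∑ i ∈ Finset.range k, G i k • prependNat (s k - s i) (x i * y k) := by
          refine Finset.sum_congr rfl fun i _ => ?_
          rw [← Finset.smul_sum, ← map_sum, ← Finset.mul_sum, ← hy k hkn']
        have b2 : ∑ i ∈ Finset.range k, ∑ j ∈ Finset.Ioc k n,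
            F k j • prependNat (s j - s k) (G i k • prependNat (s k - s i) (x i) * y j) =
            ∑ j ∈ Finset.Ioc k n, F k j • prependNat (s j - s k) (x k * y j) := by
          rw [Finset.sum_comm]
          refine Finset.sum_congr rfl fun j _ => ?_
          rw [← Finset.smul_sum, ← map_sum, ← Finset.sum_mul, ← hx k hk0 hkn]
        rw [b1, b2]
        abel
  have key2 : ∀ k ∈ Finset.range (n + 1), x k * y k =
      ∑ i ∈ Finset.range (n + 1), ∑ j ∈ Finset.range (n + 1),
        if i < j then (if i ≤ k ∧ k ≤ j then T i j k else 0) else 0 := by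
    intro k hk
    rw [key k hk]
    have hkn : k ≤ n := Nat.lt_succ_iff.mp (Finset.mem_range.mp hk)
    have i1 : Finset.range (k + 1) = (Finset.range (n + 1)).filter (· ≤ k) := by
      ext i; simp only [Finset.mem_range, Finset.mem_filter]; omega
    have i2 : Finset.Icc k n = (Finset.range (n + 1)).filter (k ≤ ·) := by
      ext i; simp only [Finset.mem_range, Finset.mem_filter, Finset.mem_Icc]; omega
    rw [i1, i2, Finset.sum_filter]
    refine Finset.sum_congr rfl fun i _ => ?_
    split_ifs with h
    · rw [Finset.sum_filter]
      refine Finset.sum_congr rfl fun j _ => ?_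
      by_cases h1 : k ≤ j <;> by_cases h2 : i < j <;> simp [h, h1, h2]
    · rw [Finset.sum_eq_zero]
      intro j _
      simp [h]
  -- For fixed i < j the vector in `T i j k` does not depend on k, so its total coefficient is the
  -- sum that `hGF` annihilates.
  rw [Finset.sum_congr rfl key2, Finset.sum_comm]
  refine Finset.sum_eq_zero fun i _ => ?_
  rw [Finset.sum_comm]
  refine Finset.sum_eq_zero fun j hj => ?_
  by_cases hij : i < j
  · have hjn : j ≤ n := Nat.lt_succ_iff.mp (Finset.mem_range.mp hj)
    have i1 : (Finset.range (n + 1)).filter (fun k => i ≤ k ∧ k ≤ j) = Finset.Icc i j := by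
      ext k; simp only [Finset.mem_range, Finset.mem_filter, Finset.mem_Icc]; omega
    simp only [hij, if_true]
    rw [← Finset.sum_filter, i1]
    simp only [T]
    rw [← Finset.sum_smul, hGF i j hij hjn, zero_smul]
  · simp [hij]

/-! ### Block sums and their coproduct. -/

/-- The image of a word under the coalgebra morphism from the words with deconcatenation to `QSym`
that is induced by the function `f`: the sum over the ways to cut the word into blocks, of the
values of `f` at the blocks times `M` of the composition of the sums of the blocks. -/
def blockSum (f : Comp → ℂ) : Comp → QSym
  | [] => 1
  | a :: w => ∑ m ∈ Finset.range (w.length + 1),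
      f (a :: w.take m) • prependNat (size (a :: w.take m)) (blockSum f (w.drop m))
  termination_by w => w.length
  decreasing_by simp

lemma blockSum_nil (f : Comp → ℂ) : blockSum f [] = 1 := by rw [blockSum]

lemma blockSum_eq (f : Comp → ℂ) {w : Comp} (hw : w ≠ []) :
    blockSum f w = ∑ m ∈ Finset.range w.length,
      f (w.take (m + 1)) • prependNat (size (w.take (m + 1))) (blockSum f (w.drop (m + 1))) := by
  cases w with
  | nil => exact absurd rfl hw
  | cons a w => rw [blockSum]; simp

/-- The lengths of the blocks add up to the length of the word, so every way of cutting carries the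
same sign. -/
lemma blockSum_sign (f : Comp → ℂ) (w : Comp) :
    blockSum (fun u => (-1) ^ u.length * f u) w = (-1 : ℂ) ^ w.length • blockSum f w := by
  induction h : w.length using Nat.strong_induction_on generalizing w with
  | _ n ih =>
    subst h
    cases w with
    | nil => simp [blockSum_nil]
    | cons a w =>
      rw [blockSum, blockSum, Finset.smul_sum]
      refine Finset.sum_congr rfl fun m hm => ?_
      rw [ih _ (by simp) (w.drop m) rfl, map_smul, smul_smul, smul_smul]
      have h : (a :: w).length = (a :: w.take m).length + (w.drop m).length := by
        rw [← List.length_append, List.cons_append, List.take_append_drop]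
      rw [h, pow_add]
      congr 1
      ring

lemma counitMap_blockSum (f : Comp → ℂ) {w : Comp} (hw : w ≠ []) :
    counitMap (blockSum f w) = 0 := by
  rw [blockSum_eq f hw, map_sum]
  refine Finset.sum_eq_zero fun m _ => ?_
  rw [map_smul, prependNat, counitMap_prepend, smul_zero]

/-- Remove the first block: a cut of the resulting composition lies either before it, giving the
term 1 ⊗ `blockSum f w`, or after it, where induction on the remaining word applies. -/
lemma comulMap_blockSum (f : Comp → ℂ) (w : Comp) : comulMap (blockSum f w) =
    ∑ k ∈ Finset.range (w.length + 1), blockSum f (w.take k) ⊗ₜ[ℂ] blockSum f (w.drop k) := by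
  induction h : w.length using Nat.strong_induction_on generalizing w with
  | _ n ih =>
    subst h
    by_cases hw : w = []
    · subst hw
      simp [blockSum_nil, comulMap_one, Algebra.TensorProduct.one_def]
    have h1 : comulMap (blockSum f w) = 1 ⊗ₜ[ℂ] blockSum f w +
        ∑ m ∈ Finset.range w.length, ∑ k ∈ Finset.range (w.length - (m + 1) + 1),
          (f (w.take (m + 1)) • prependNat (size (w.take (m + 1)))
            (blockSum f ((w.drop (m + 1)).take k))) ⊗ₜ[ℂ] blockSum f (w.drop (m + 1 + k)) := by
      conv_lhs => rw [blockSum_eq f hw]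
      conv_rhs => enter [1]; rw [blockSum_eq f hw]
      rw [map_sum, TensorProduct.tmul_sum, ← Finset.sum_add_distrib]
      refine Finset.sum_congr rfl fun m hm => ?_
      rw [Finset.mem_range] at hm
      rw [map_smul, prependNat, comulMap_prepend, ih _ _ (w.drop (m + 1)) rfl, smul_add,
        TensorProduct.tmul_smul, map_sum, Finset.smul_sum, List.length_drop]
      · congr 1
        refine Finset.sum_congr rfl fun k _ => ?_
        rw [LinearMap.rTensor_tmul, List.drop_drop, TensorProduct.smul_tmul']
      · rw [List.length_drop]; omega
    rw [h1, Finset.sum_range_succ', add_comm]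
    congr 1
    · have h2 : ∀ k ∈ Finset.range w.length,
          blockSum f (w.take (k + 1)) ⊗ₜ[ℂ] blockSum f (w.drop (k + 1)) =
          ∑ m ∈ Finset.range (w.take (k + 1)).length, (f ((w.take (k + 1)).take (m + 1)) •
            prependNat (size ((w.take (k + 1)).take (m + 1)))
              (blockSum f ((w.take (k + 1)).drop (m + 1)))) ⊗ₜ[ℂ] blockSum f (w.drop (k + 1)) := by
        intro k hk
        rw [Finset.mem_range] at hk
        rw [← TensorProduct.sum_tmul, ← blockSum_eq]
        rw [← List.length_pos_iff, List.length_take]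
        omega
      rw [Finset.sum_congr rfl h2, Finset.sum_sigma', Finset.sum_sigma']
      -- The first block has m + 1 letters and the cut comes k letters later, that is, after (m + k)
      -- + 1 letters.
      refine Finset.sum_bij' (fun p _ => ⟨p.1 + p.2, p.1⟩) (fun p _ => ⟨p.2, p.1 - p.2⟩) ?_ ?_ ?_ ?_ ?_
      · rintro ⟨m, k⟩ h
        simp only [Finset.mem_sigma, Finset.mem_range, List.length_take] at h ⊢
        omega
      · rintro ⟨m, k⟩ h
        simp only [Finset.mem_sigma, Finset.mem_range, List.length_take] at h ⊢
        omega
      · rintro ⟨m, k⟩ h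
        simp
      · rintro ⟨m, k⟩ h
        simp only [Finset.mem_sigma, Finset.mem_range, List.length_take] at h
        simp only [Sigma.mk.injEq, heq_eq_eq, and_true]
        omega
      · rintro ⟨m, k⟩ h
        have e1 : (w.take (m + k + 1)).take (m + 1) = w.take (m + 1) := by
          rw [List.take_take]; congr 1; omega
        have e2 : (w.take (m + k + 1)).drop (m + 1) = (w.drop (m + 1)).take k := by
          rw [List.drop_take]; congr 1; omega
        have e3 : m + k + 1 = m + 1 + k := by omega
        simp only [e1, e2]
        rw [e3]
    · simp [blockSum_nil]

/-! ### Sizes of segments and the antipode of block sums. -/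

lemma size_append (u v : Comp) : size (u ++ v) = size u + size v := by
  simp [size]

lemma size_reverse (u : Comp) : size u.reverse = size u := by
  simp [size, List.sum_reverse]

lemma size_pos {u : Comp} (hu : u ≠ []) : 0 < size u := by
  cases u with
  | nil => exact absurd rfl hu
  | cons a u => simp [size]

lemma size_take_add (w : Comp) {i j : ℕ} (h : i ≤ j) :
    size (w.take j) = size (w.take i) + size ((w.take j).drop i) := by
  rw [← size_append]
  congr 1
  conv_lhs => rw [← List.take_append_drop i (w.take j)]
  rw [List.take_take, min_eq_left h]

/-- Mutually inverse functions give block sums that are inverse to each other. -/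
lemma sum_blockSum_mul_blockSum (f g : Comp → ℂ) (hf : f [] = 1) (hg : g [] = 1)
    (hgf : conv (fun u : Comp => g u.reverse) f = convOne) {w : Comp} (hw : w ≠ []) :
    ∑ k ∈ Finset.range (w.length + 1),
      blockSum g (w.take k).reverse * blockSum f (w.drop k) = 0 := by
  refine sum_mul_eq_zero_of_inverse_weights (List.length_pos_iff.mpr hw)
    (fun i => size (w.take i)) ?_ (fun i j => f ((w.take j).drop i))
    (fun i j => g ((w.take j).drop i).reverse) ?_ ?_ ?_ _ _ ?_ ?_ ?_ ?_
  · intro i j hij hj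
    show size (w.take i) < size (w.take j)
    rw [size_take_add w hij.le]
    have : 0 < size ((w.take j).drop i) := size_pos (by
      rw [← List.length_pos_iff, List.length_drop, List.length_take]; omega)
    omega
  · intro k; simp [hf]
  · intro k; simp [hg]
  · intro i j hij hj
    -- The sum over k from i to j is the convolution of the two functions on the segment of w
    -- between i and j, which is nonempty.
    have h := congrFun hgf ((w.take j).drop i)
    have hl : ((w.take j).drop i).length = j - i := by
      rw [List.length_drop, List.length_take]; omega
    rw [conv_eq_sum, hl] at h
    have h0 : convOne ((w.take j).drop i) = 0 := by
      cases e : (w.take j).drop i with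
      | nil => rw [e] at hl; simp at hl; omega
      | cons a v => rfl
    rw [h0] at h
    rw [← h, ← Finset.Ico_add_one_right_eq_Icc, Finset.sum_Ico_eq_sum_range,
      show j + 1 - i = j - i + 1 by omega]
    refine Finset.sum_congr rfl fun k hk => ?_
    rw [Finset.mem_range] at hk
    have e1 : (w.take (i + k)).drop i = ((w.take j).drop i).take k := by
      rw [List.take_drop, List.take_take]
      congr 2; omega
    rw [e1, List.drop_drop]
  · simp [blockSum_nil]
  · simp [blockSum_nil]
  · intro k hk hkn
    have hl : (w.take k).length = k := by rw [List.length_take]; omega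
    -- The first block of the reversed prefix is the last block of the prefix; after reflection of
    -- the index, i is the position where it starts.
    rw [blockSum_eq g (by rw [← List.length_pos_iff, List.length_reverse]; omega),
      List.length_reverse, hl, ← Finset.sum_range_reflect]
    refine Finset.sum_congr rfl fun i hi => ?_
    rw [Finset.mem_range] at hi
    have e1 : k - (k - 1 - i + 1) = i := by omega
    simp only [List.take_reverse, List.drop_reverse, hl, e1, size_reverse]
    have e2 : (w.take k).take i = w.take i := by rw [List.take_take, min_eq_left hi.le]
    have e3 := size_take_add w hi.le
    rw [e2, show size ((w.take k).drop i) = size (w.take k) - size (w.take i) by omega]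
  · intro k hk
    rw [blockSum_eq f (by rw [← List.length_pos_iff, List.length_drop]; omega),
      List.length_drop, ← Finset.Ico_add_one_add_one_eq_Ioc, Finset.sum_Ico_eq_sum_range]
    refine Finset.sum_congr (by congr 1; omega) fun m hm => ?_
    rw [Finset.mem_range] at hm
    have e1 : (w.take (k + 1 + m)).drop k = (w.drop k).take (m + 1) := by
      rw [List.drop_take]; congr 1; omega
    have e3 := size_take_add w (i := k) (j := k + 1 + m) (by omega)
    rw [e1] at e3
    rw [e1, List.drop_drop, show k + (m + 1) = k + 1 + m by omega,
      show size ((w.drop k).take (m + 1)) = size (w.take (k + 1 + m)) - size (w.take k) by omega]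

/-- The antipode axiom at `blockSum f w`, where the counit vanishes and the coproduct is
deconcatenation. -/
lemma sum_antipode_blockSum_mul (f : Comp → ℂ) {w : Comp} (hw : w ≠ []) :
    ∑ k ∈ Finset.range (w.length + 1),
      HopfAlgebra.antipode ℂ (blockSum f (w.take k)) * blockSum f (w.drop k) = 0 := by
  have h := HopfAlgebra.mul_antipode_rTensor_comul_apply (R := ℂ) (blockSum f w)
  have h1 : CoalgebraStruct.counit (R := ℂ) (blockSum f w) = 0 := counitMap_blockSum f hw
  have h2 : CoalgebraStruct.comul (R := ℂ) (blockSum f w) = comulMap (blockSum f w) := rfl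
  rw [h1, h2, comulMap_blockSum, map_zero, map_sum, map_sum] at h
  simpa using h

/-- Two vanishing sums have the same right factors and, by induction, the same left factors at all
proper prefixes. Hence the last terms agree too, and there the right factor is 1. -/
lemma antipode_blockSum (f g : Comp → ℂ) (hf : f [] = 1) (hg : g [] = 1)
    (hgf : conv (fun u : Comp => g u.reverse) f = convOne) (w : Comp) :
    HopfAlgebra.antipode ℂ (blockSum f w) = blockSum g w.reverse := by
  induction h : w.length using Nat.strong_induction_on generalizing w with
  | _ n ih =>
    subst h
    by_cases hw : w = []
    · subst hw
      simp [blockSum_nil]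
    have h1 := sum_antipode_blockSum_mul f hw
    have h2 := sum_blockSum_mul_blockSum f g hf hg hgf hw
    rw [Finset.sum_range_succ] at h1 h2
    rw [Finset.sum_congr rfl fun k hk => by
      rw [ih (w.take k).length (by
        rw [Finset.mem_range] at hk
        rw [List.length_take]; omega) (w.take k) rfl]] at h1
    have h3 := add_left_cancel (h1.trans h2.symm)
    simpa [blockSum_nil] using h3

lemma antipode_blockSum_weight (w : Comp) : HopfAlgebra.antipode ℂ (blockSum weight w) =
    (-1 : ℂ) ^ w.length • blockSum weight w.reverse := by
  rw [antipode_blockSum weight signWeight weight_nil signWeight_nil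
    signWeight_reverse_conv_weight, ← List.length_reverse, ← blockSum_sign]
  rfl

end QSym

end

/-! ### The interval m_o(α) ≤ β ≤ α as the set of cuts into even-then-odd blocks. -/

noncomputable section

namespace Comp

open QSym
open scoped Nat

lemma size_cons (a : ℕ+) (u : Comp) : size (a :: u) = a + size u := by
  simp [size]

lemma size_eq_zero {u : Comp} : size u = 0 ↔ u = [] := by
  refine ⟨fun h => ?_, fun h => by simp [h, size]⟩
  by_contra hu
  have := size_pos hu
  omega

/-! ### Partial sums -/

lemma mem_partialSums {α : Comp} {s : ℕ} :
    s ∈ α.partialSums ↔ ∃ u v, α = u ++ v ∧ u ≠ [] ∧ v ≠ [] ∧ size u = s := by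
  simp only [partialSums, Finset.mem_image, Finset.mem_range]
  constructor
  · rintro ⟨k, hk, rfl⟩
    refine ⟨α.take (k + 1), α.drop (k + 1), (List.take_append_drop _ _).symm, ?_, ?_, rfl⟩
    · rw [← List.length_pos_iff, List.length_take]; omega
    · rw [← List.length_pos_iff, List.length_drop]; omega
  · rintro ⟨u, v, rfl, hu, hv, rfl⟩
    rw [← List.length_pos_iff] at hu hv
    -- Index k in `partialSums` stands for the prefix of length k + 1.
    refine ⟨u.length - 1, by rw [List.length_append]; omega, ?_⟩
    rw [Nat.sub_add_cancel hu, List.take_left']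
    rfl

lemma mem_partialSums_cons {a : ℕ+} {w : Comp} {s : ℕ} : s ∈ partialSums (a :: w) ↔
    w ≠ [] ∧ (s = a ∨ ∃ t ∈ partialSums w, s = a + t) := by
  rw [mem_partialSums]
  constructor
  · rintro ⟨u, v, h, hu, hv, rfl⟩
    cases u with
    | nil => exact absurd rfl hu
    | cons b u =>
      obtain ⟨rfl, rfl⟩ := List.cons.inj h
      refine ⟨by simp [hv], ?_⟩
      rw [size_cons]
      by_cases hu0 : u = []
      · left; simp [hu0, size]
      · right; exact ⟨size u, mem_partialSums.mpr ⟨u, v, rfl, hu0, hv, rfl⟩, rfl⟩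
  · rintro ⟨hw, rfl | ⟨t, ht, rfl⟩⟩
    · exact ⟨[a], w, rfl, by simp, hw, by simp [size]⟩
    · obtain ⟨u, v, rfl, hu, hv, rfl⟩ := mem_partialSums.mp ht
      exact ⟨a :: u, v, rfl, by simp, hv, size_cons a u⟩

lemma pos_of_mem_partialSums {α : Comp} {s : ℕ} (h : s ∈ α.partialSums) : 0 < s := by
  obtain ⟨u, v, -, hu, -, rfl⟩ := mem_partialSums.mp h
  exact size_pos hu

lemma lt_size_of_mem_partialSums {α : Comp} {s : ℕ} (h : s ∈ α.partialSums) : s < size α := by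
  obtain ⟨u, v, rfl, -, hv, rfl⟩ := mem_partialSums.mp h
  have := size_pos hv
  rw [size_append]
  omega

lemma mem_partialSums_append {u v : Comp} {s : ℕ} (hv : v ≠ []) : s ∈ partialSums (u ++ v) ↔
    s ∈ partialSums u ∨ (u ≠ [] ∧ s = size u) ∨ ∃ t ∈ partialSums v, s = size u + t := by
  induction u generalizing s with
  | nil => simp [partialSums, size]
  | cons a u ih =>
    rw [List.cons_append, mem_partialSums_cons, mem_partialSums_cons, size_cons]
    simp only [ih]
    by_cases hu : u = []
    · subst hu
      simp [hv, partialSums, size]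
    · simp only [ne_eq, List.append_eq_nil_iff, hu, hv, false_and, not_false_eq_true, true_and,
        reduceCtorEq]
      constructor
      · rintro (rfl | ⟨t, ht | rfl | ⟨r, hr, rfl⟩, rfl⟩)
        · exact Or.inl (Or.inl rfl)
        · exact Or.inl (Or.inr ⟨t, ht, rfl⟩)
        · exact Or.inr (Or.inl rfl)
        · exact Or.inr (Or.inr ⟨r, hr, by omega⟩)
      · rintro ((rfl | ⟨t, ht, rfl⟩) | rfl | ⟨t, ht, rfl⟩)
        · exact Or.inl rfl
        · exact Or.inr ⟨t, Or.inl ht, rfl⟩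
        · exact Or.inr ⟨_, Or.inr (Or.inl rfl), rfl⟩
        · exact Or.inr ⟨size u + t, Or.inr (Or.inr ⟨t, ht, rfl⟩), by omega⟩

lemma oddMin_ne_nil (a : ℕ+) (w : Comp) : oddMin (a :: w) ≠ [] := by
  cases w with
  | nil => simp [oddMin]
  | cons b w =>
    rw [oddMin]
    split_ifs
    · simp
    · split <;> simp

lemma mem_partialSums_oddMin_cons {a b : ℕ+} {w : Comp} {s : ℕ} :
    s ∈ partialSums (oddMin (a :: b :: w)) ↔
      (Odd (a : ℕ) ∧ Even (b : ℕ) ∧ s = a) ∨ ∃ t ∈ partialSums (oddMin (b :: w)), s = a + t := by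
  rw [oddMin]
  have h0 := oddMin_ne_nil b w
  split_ifs with h
  · rw [mem_partialSums_cons]
    simp [h0, h.1, h.2]
  · generalize oddMin (b :: w) = z at h0
    cases z with
    | nil => exact absurd rfl h0
    | cons c r =>
      simp only [mem_partialSums_cons, PNat.add_coe]
      constructor
      · rintro ⟨hr, rfl | ⟨t, ht, rfl⟩⟩
        · exact Or.inr ⟨c, ⟨hr, Or.inl rfl⟩, rfl⟩
        · exact Or.inr ⟨c + t, ⟨hr, Or.inr ⟨t, ht, rfl⟩⟩, by omega⟩
      · rintro (⟨h1, h2, -⟩ | ⟨t, ⟨hr, rfl | ⟨r, hr', rfl⟩⟩, rfl⟩)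
        · exact absurd ⟨h1, h2⟩ h
        · exact ⟨hr, Or.inl rfl⟩
        · exact ⟨hr, Or.inr ⟨r, hr', by omega⟩⟩

lemma size_oddMin (α : Comp) : size (oddMin α) = size α := by
  induction α with
  | nil => rw [oddMin]
  | cons a w ih =>
    cases w with
    | nil => rw [oddMin]
    | cons b w =>
      rw [oddMin, size_cons a, ← ih]
      have h0 := oddMin_ne_nil b w
      split_ifs with h
      · rw [size_cons]
      · generalize oddMin (b :: w) = z at h0
        cases z with
        | nil => exact absurd rfl h0
        | cons c r => simp only [size_cons, PNat.add_coe]; omega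

lemma mem_partialSums_oddMin {α : Comp} {s : ℕ} : s ∈ partialSums (oddMin α) ↔
    ∃ (u : Comp) (a b : ℕ+) (v : Comp), α = u ++ a :: b :: v ∧ Odd (a : ℕ) ∧ Even (b : ℕ) ∧ s = size u + a := by
  induction α generalizing s with
  | nil => simp [oddMin, partialSums]
  | cons a w ih =>
    cases w with
    | nil =>
      simp only [oddMin, partialSums, List.length_cons, List.length_nil]
      simp only [zero_add, tsub_self, Finset.range_zero, Finset.image_empty, Finset.notMem_empty,
        false_iff]
      rintro ⟨u, a', b, v, h, -⟩
      have := congrArg List.length h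
      simp at this
      omega
    | cons b w =>
      rw [mem_partialSums_oddMin_cons]
      simp only [ih]
      constructor
      · rintro (⟨h1, h2, rfl⟩ | ⟨t, ⟨u, a', b', v, h, h1, h2, rfl⟩, rfl⟩)
        · exact ⟨[], a, b, w, rfl, h1, h2, by simp [size]⟩
        · refine ⟨a :: u, a', b', v, by rw [h]; rfl, h1, h2, ?_⟩
          rw [size_cons]; omega
      · rintro ⟨u, a', b', v, h, h1, h2, rfl⟩
        cases u with
        | nil =>
          simp only [List.nil_append, List.cons.injEq] at h
          obtain ⟨rfl, rfl, rfl⟩ := h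
          exact Or.inl ⟨h1, h2, by simp [size]⟩
        | cons c u =>
          obtain ⟨rfl, hw⟩ := List.cons.inj h
          refine Or.inr ⟨_, ⟨u, a', b', v, hw, h1, h2, rfl⟩, ?_⟩
          rw [size_cons]; omega

lemma partialSums_oddMin_eq_empty {α : Comp} : partialSums (oddMin α) = ∅ ↔ EvenOdd α := by
  rw [Finset.eq_empty_iff_forall_notMem, EvenOdd]
  simp only [mem_partialSums_oddMin]
  -- Transitivity reduces the condition on all pairs of letters to adjacent pairs, which is what
  -- `oddMin` sees.
  have htrans : IsTrans ℕ+ fun a b : ℕ+ => Odd (a : ℕ) → Odd (b : ℕ) :=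
    ⟨fun a b c hab hbc h => hbc (hab h)⟩
  rw [← List.isChain_iff_pairwise, List.isChain_iff_forall_rel_of_append_cons_cons]
  constructor
  · intro h a b u v e ha
    by_contra hb
    exact h _ ⟨u, a, b, v, e, ha, Nat.not_odd_iff_even.mp hb, rfl⟩
  · rintro h s ⟨u, a, b, v, e, ha, hb, -⟩
    exact Nat.not_odd_iff_even.mpr hb (h e ha)

/-- Whether `oddMin` cuts depends only on the two adjacent letters, so concatenation can create a
new cut only at the seam, which is excluded here. -/
lemma mem_partialSums_oddMin_append {u v : Comp} {s : ℕ} (hs : s ≠ size u) :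
    s ∈ partialSums (oddMin (u ++ v)) ↔
      s ∈ partialSums (oddMin u) ∨ ∃ t ∈ partialSums (oddMin v), s = size u + t := by
  induction u generalizing s with
  | nil => simp [oddMin, partialSums, size]
  | cons a u ih =>
    rw [size_cons] at hs ⊢
    cases u with
    | nil =>
      have e : partialSums (oddMin [a]) = ∅ := by simp [oddMin, partialSums]
      simp only [e, Finset.notMem_empty, false_or]
      cases v with
      | nil => simp [oddMin, partialSums]
      | cons b v =>
        rw [List.cons_append, List.nil_append, mem_partialSums_oddMin_cons]
        simp only [size, List.map_nil, List.sum_nil, add_zero] at hs ⊢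
        simp [hs]
    | cons b u =>
      rw [List.cons_append, List.cons_append, mem_partialSums_oddMin_cons,
        mem_partialSums_oddMin_cons, ← List.cons_append]
      constructor
      · rintro (h | ⟨t, ht, rfl⟩)
        · exact Or.inl (Or.inl h)
        · rcases (ih (by omega)).mp ht with h | ⟨r, hr, rfl⟩
          · exact Or.inl (Or.inr ⟨t, h, rfl⟩)
          · exact Or.inr ⟨r, hr, by omega⟩
      · rintro ((h | ⟨t, ht, rfl⟩) | ⟨r, hr, rfl⟩)
        · exact Or.inl h
        · exact Or.inr ⟨t, (ih (by omega)).mpr (Or.inl ht), rfl⟩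
        · exact Or.inr ⟨_, (ih (by omega)).mpr (Or.inr ⟨r, hr, rfl⟩), by omega⟩

/-! ### The interval -/

lemma mem_interval {α β : Comp} :
    β ∈ interval α ↔ Coarsens (oddMin α) β ∧ Coarsens β α := by
  simp [interval]

lemma mem_interval_iff {α β : Comp} : β ∈ interval α ↔ β.size = α.size ∧
    β.partialSums ⊆ α.partialSums ∧ (oddMin α).partialSums ⊆ β.partialSums := by
  rw [mem_interval, Coarsens, Coarsens, size_oddMin]
  constructor
  · rintro ⟨⟨h1, h2⟩, h3, h4⟩; exact ⟨h3, h4, h2⟩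
  · rintro ⟨h1, h2, h3⟩; exact ⟨⟨h1.symm, h3⟩, h1, h2⟩

lemma interval_nil : interval [] = {[]} := by
  ext β
  rw [mem_interval_iff, Finset.mem_singleton]
  constructor
  · rintro ⟨h, -⟩
    exact size_eq_zero.mp (h.trans (size_eq_zero.mpr rfl))
  · rintro rfl
    simp [oddMin]

/-- Compare partial sums with b = `size u`. Below b the composition `b :: β` has none, which forces
`oddMin u` to have none; above b everything is a translate by b of the conditions on β and v. -/
lemma cons_mem_interval_append {u v β : Comp} {b : ℕ+} (hu : u ≠ []) (hb : size u = b) :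
    b :: β ∈ interval (u ++ v) ↔ EvenOdd u ∧ β ∈ interval v := by
  have hpos := b.pos
  -- For empty v the number b is the total size and not a partial sum.
  by_cases hv : v = []
  · subst hv
    rw [interval_nil, List.append_nil, mem_interval_iff, Finset.mem_singleton, size_cons, hb]
    constructor
    · rintro ⟨h1, h2, h3⟩
      have h4 : β = [] := size_eq_zero.mp (by omega)
      subst h4
      refine ⟨partialSums_oddMin_eq_empty.mp ?_, rfl⟩
      exact Finset.subset_empty.mp (by simpa [partialSums] using h3)
    · rintro ⟨h, rfl⟩
      rw [partialSums_oddMin_eq_empty.mpr h]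
      simp [partialSums, size]
  · rw [mem_interval_iff, mem_interval_iff, size_cons, size_append, hb, add_right_inj]
    have hvpos := size_pos hv
    constructor
    · rintro ⟨h1, h2, h3⟩
      have hβ : β ≠ [] := by
        rintro rfl
        rw [size_eq_zero.mpr rfl] at h1
        omega
      refine ⟨partialSums_oddMin_eq_empty.mp ?_, h1, ?_, ?_⟩
      · rw [Finset.eq_empty_iff_forall_notMem]
        intro s hs
        have hlt := lt_size_of_mem_partialSums hs
        rw [size_oddMin, hb] at hlt
        have h := h3 ((mem_partialSums_oddMin_append (by omega)).mpr (Or.inl hs))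
        rw [mem_partialSums_cons] at h
        rcases h.2 with rfl | ⟨t, -, rfl⟩ <;> omega
      · intro s hs
        have hs0 := pos_of_mem_partialSums hs
        have h := h2 (mem_partialSums_cons.mpr ⟨hβ, Or.inr ⟨s, hs, rfl⟩⟩)
        rw [mem_partialSums_append hv] at h
        rcases h with h | ⟨-, h⟩ | ⟨t, ht, h⟩
        · have := lt_size_of_mem_partialSums h
          omega
        · omega
        · rw [hb, add_right_inj] at h
          rwa [h]
      · intro s hs
        have hs0 := pos_of_mem_partialSums hs
        have h := h3 ((mem_partialSums_oddMin_append (u := u) (by omega)).mpr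
          (Or.inr ⟨s, hs, rfl⟩))
        rw [mem_partialSums_cons, hb] at h
        rcases h.2 with h | ⟨t, ht, h⟩
        · omega
        · rw [add_right_inj] at h
          rwa [h]
    · rintro ⟨hE, h1, h2, h3⟩
      have hβ : β ≠ [] := by
        rintro rfl
        rw [size_eq_zero.mpr rfl] at h1
        omega
      refine ⟨h1, ?_, ?_⟩
      · intro s hs
        rw [mem_partialSums_append hv, hb]
        rcases (mem_partialSums_cons.mp hs).2 with h | ⟨t, ht, h⟩
        · exact Or.inr (Or.inl ⟨hu, h⟩)
        · exact Or.inr (Or.inr ⟨t, h2 ht, h⟩)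
      · intro s hs
        rw [mem_partialSums_cons]
        refine ⟨hβ, ?_⟩
        -- The seam b is a partial sum of `b :: β` in any case, so it does not matter whether
        -- `oddMin` cuts there.
        by_cases hsb : s = b
        · exact Or.inl hsb
        · rw [mem_partialSums_oddMin_append (by rwa [hb]),
            partialSums_oddMin_eq_empty.mpr hE, hb] at hs
          rcases hs with h | ⟨t, ht, h⟩
          · simp at h
          · exact Or.inr ⟨t, h3 ht, h⟩

lemma exists_append_of_cons_mem_interval {α β : Comp} {b : ℕ+} (h : b :: β ∈ interval α) :
    ∃ u v, α = u ++ v ∧ u ≠ [] ∧ size u = b := by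
  rw [mem_interval_iff, size_cons] at h
  obtain ⟨h1, h2, -⟩ := h
  by_cases hβ : β = []
  · subst hβ
    rw [size_eq_zero.mpr rfl] at h1
    have := b.pos
    refine ⟨α, [], by simp, ?_, by omega⟩
    rintro rfl
    rw [size_eq_zero.mpr rfl] at h1
    omega
  · obtain ⟨u, v, h, hu, -, hs⟩ :=
      mem_partialSums.mp (h2 (mem_partialSums_cons.mpr ⟨hβ, Or.inl rfl⟩))
    exact ⟨u, v, h, hu, hs⟩

open Classical in
lemma interval_eq_biUnion {α : Comp} (hα : α ≠ []) : interval α =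
    ((Finset.range α.length).filter fun m => EvenOdd (α.take (m + 1))).biUnion fun m =>
      (interval (α.drop (m + 1))).image (List.cons (size (α.take (m + 1))).toPNat') := by
  -- Prefixes with m + 1 letters have positive size, so the value 1 of `toPNat'` at 0 never
  -- interferes.
  have hsize : ∀ m < α.length, α.take (m + 1) ≠ [] ∧
      size (α.take (m + 1)) = ((size (α.take (m + 1))).toPNat' : ℕ) := by
    intro m hm
    have h : α.take (m + 1) ≠ [] := by
      rw [← List.length_pos_iff, List.length_take]; omega
    refine ⟨h, ?_⟩
    rw [Nat.toPNat'_coe, if_pos (size_pos h)]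
  ext β
  simp only [Finset.mem_biUnion, Finset.mem_filter, Finset.mem_range, Finset.mem_image]
  constructor
  · intro h
    cases β with
    | nil =>
      have h1 := (mem_interval_iff.mp h).1
      rw [size_eq_zero.mpr rfl] at h1
      exact absurd (size_eq_zero.mp h1.symm) hα
    | cons b β =>
      obtain ⟨u, v, rfl, hu, hb⟩ := exists_append_of_cons_mem_interval h
      have h2 := (cons_mem_interval_append hu hb).mp h
      have hl := List.length_pos_iff.mpr hu
      have e : u.length - 1 + 1 = u.length := Nat.sub_add_cancel hl
      refine ⟨u.length - 1, ⟨by rw [List.length_append]; omega, ?_⟩, β, ?_, ?_⟩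
      · rw [e, List.take_left']
        exacts [h2.1, rfl]
      · rw [e, List.drop_left']
        exacts [h2.2, rfl]
      · rw [e, List.take_left' rfl, hb, PNat.coe_toPNat']
  · rintro ⟨m, ⟨hm, hE⟩, β, hβ, rfl⟩
    have h := (cons_mem_interval_append (hsize m hm).1 (hsize m hm).2).mpr ⟨hE, hβ⟩
    rwa [List.take_append_drop] at h

/-! ### The coefficients -/

/-- The number of parts of `α` with property `Q` and with partial sum in `R`. -/
def countParts (R Q : ℕ → Prop) [DecidablePred R] [DecidablePred Q] (α : Comp) : ℕ :=
  (Finset.univ.filter fun j : Fin α.length => R (size (α.take (j + 1))) ∧ Q (α.get j)).card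

lemma countParts_cons (R Q : ℕ → Prop) [DecidablePred R] [DecidablePred Q] (a : ℕ+) (w : Comp) :
    countParts R Q (a :: w) =
      (if R a ∧ Q a then 1 else 0) + countParts (fun s => R (a + s)) Q w := by
  rw [countParts, countParts, Finset.card_filter, Finset.card_filter]
  erw [Fin.sum_univ_succ]
  simp [size_cons, size_eq_zero.mpr]

lemma countParts_append (R Q : ℕ → Prop) [DecidablePred R] [DecidablePred Q] (u v : Comp) :
    countParts R Q (u ++ v) = countParts R Q u + countParts (fun s => R (size u + s)) Q v := by
  induction u generalizing R with
  | nil => simp [countParts, size]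
  | cons a u ih =>
    rw [List.cons_append, countParts_cons, countParts_cons, ih, add_assoc]
    simp only [size_cons, add_assoc]

lemma size_take_succ_pos {α : Comp} (j : Fin α.length) : 0 < size (α.take (j + 1)) :=
  size_pos (by
    have := j.2
    rw [← List.length_pos_iff, List.length_take]; omega)

lemma size_take_le (α : Comp) (k : ℕ) : size (α.take k) ≤ size α := by
  conv_rhs => rw [← List.take_append_drop k α, size_append]
  omega

lemma countParts_congr {R R' Q : ℕ → Prop} [DecidablePred R] [DecidablePred R']
    [DecidablePred Q] {α : Comp} (h : ∀ s, 0 < s → s ≤ size α → (R s ↔ R' s)) :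
    countParts R Q α = countParts R' Q α := by
  rw [countParts, countParts]
  congr 1
  ext j
  simp only [Finset.mem_filter, Finset.mem_univ, true_and]
  rw [h _ (size_take_succ_pos j) (size_take_le α _)]

lemma countParts_eq_zero {R Q : ℕ → Prop} [DecidablePred R] [DecidablePred Q] {α : Comp}
    (h : ∀ s, 0 < s → s ≤ size α → ¬ R s) : countParts R Q α = 0 := by
  rw [countParts, Finset.card_eq_zero, Finset.filter_eq_empty_iff]
  intro j _ hj
  exact h _ (size_take_succ_pos j) (size_take_le α _) hj.1

lemma countParts_true (Q : ℕ → Prop) [DecidablePred Q] (α : Comp) :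
    countParts (fun _ => True) Q α = α.countP fun a : ℕ+ => decide (Q a) := by
  induction α with
  | nil => simp [countParts]
  | cons a w ih =>
    rw [countParts_cons, ih, List.countP_cons]
    simp [add_comm]

lemma oddCount_eq (α β : Comp) (i : ℕ) : oddCount α β i = countParts
    (fun s => size (β.take i) < s ∧ s ≤ size (β.take (i + 1))) Odd α := by
  rw [oddCount, block, Finset.filter_filter]
  rfl

lemma evenCount_eq (α β : Comp) (i : ℕ) : evenCount α β i = countParts
    (fun s => size (β.take i) < s ∧ s ≤ size (β.take (i + 1))) Even α := by
  rw [evenCount, block, Finset.filter_filter]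
  rfl

lemma countParts_head (Q : ℕ → Prop) [DecidablePred Q] (u v : Comp) :
    countParts (fun s => 0 < s ∧ s ≤ size u) Q (u ++ v) =
      u.countP fun a : ℕ+ => decide (Q a) := by
  rw [countParts_append, ← countParts_true, countParts_eq_zero (α := v), add_zero]
  · exact countParts_congr fun s h1 h2 => by simp [h1, h2]
  · intro s h1 h2 h
    omega

lemma countParts_tail (Q : ℕ → Prop) [DecidablePred Q] (u v : Comp) (m n : ℕ) :
    countParts (fun s => size u + m < s ∧ s ≤ size u + n) Q (u ++ v) =
      countParts (fun s => m < s ∧ s ≤ n) Q v := by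
  rw [countParts_append, countParts_eq_zero (α := u), zero_add]
  · exact countParts_congr fun s h1 h2 => by omega
  · intro s h1 h2 h
    omega

/-- The window (0, b] contains the partial sums at exactly the letters of u; all later windows lie
beyond `size u` and translate to the windows of β on v. -/
lemma coeff_append_cons {u v β : Comp} {b : ℕ+} (hb : size u = b) :
    coeff (u ++ v) (b :: β) =
      1 / (((u.countP fun a : ℕ+ => decide (Odd (a : ℕ)))! : ℂ) *
        ((u.countP fun a : ℕ+ => decide (Even (a : ℕ)))! : ℂ)) * coeff v β := by
  rw [coeff, coeff, List.length_cons, Finset.prod_range_succ', mul_comm]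
  have h0 : size ([] : Comp) = 0 := rfl
  congr 1
  · rw [oddCount_eq, evenCount_eq]
    simp only [List.take_zero, List.take_succ_cons, zero_add, size_cons, h0, add_zero, ← hb,
      countParts_head]
  · refine Finset.prod_congr rfl fun i _ => ?_
    rw [oddCount_eq, evenCount_eq, oddCount_eq, evenCount_eq]
    simp only [List.take_succ_cons, size_cons, ← hb, countParts_tail]

end Comp

/-! ### The shuffle basis as block sums. -/

namespace QSym

open Comp

lemma S_nil : S [] = 1 := by
  simp [S, interval_nil, Comp.coeff, M_nil]

/-- This is the recursion of `blockSum weight`: sort the interval by the first block, whose factor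
splits off the coefficient. First blocks that are not even-then-odd are absent from the interval and
have weight 0. -/
lemma S_eq {α : Comp} (hα : α ≠ []) : S α = ∑ m ∈ Finset.range α.length,
    weight (α.take (m + 1)) • prependNat (size (α.take (m + 1))) (S (α.drop (m + 1))) := by
  classical
  have hsize : ∀ m < α.length,
      size (α.take (m + 1)) = ((size (α.take (m + 1))).toPNat' : ℕ) := by
    intro m hm
    rw [Nat.toPNat'_coe, if_pos (size_pos _)]
    rw [← List.length_pos_iff, List.length_take]; omega
  rw [S, interval_eq_biUnion hα, Finset.sum_biUnion, Finset.sum_filter]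
  · refine Finset.sum_congr rfl fun m hm => ?_
    rw [Finset.mem_range] at hm
    rw [weight_eq]
    split_ifs with hE
    · rw [Finset.sum_image fun _ _ _ _ h => (List.cons.inj h).2, S, map_sum, Finset.smul_sum]
      refine Finset.sum_congr rfl fun β _ => ?_
      have h := coeff_append_cons (v := α.drop (m + 1)) (β := β) (hsize m hm)
      rw [List.take_append_drop] at h
      rw [h, map_smul, smul_smul, prependNat, prepend_M]
    · rw [zero_smul]
  -- The first part of β is a prefix sum of α, and prefix sums increase strictly, so it determines
  -- the first block.
  · intro m hm m' hm' hne
    simp only [Finset.coe_filter, Finset.mem_range] at hm hm'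
    have hlt : ∀ i j, i < j → j < α.length → size (α.take (i + 1)) < size (α.take (j + 1)) := by
      intro i j hij hj
      rw [size_take_add α (i := i + 1) (j := j + 1) (by omega)]
      have : 0 < size ((α.take (j + 1)).drop (i + 1)) := size_pos (by
        rw [← List.length_pos_iff, List.length_drop, List.length_take]; omega)
      omega
    rw [Function.onFun, Finset.disjoint_left]
    intro β h1 h2
    obtain ⟨γ, -, rfl⟩ := Finset.mem_image.mp h1
    obtain ⟨γ', -, h⟩ := Finset.mem_image.mp h2
    have h3 : size (α.take (m' + 1)) = size (α.take (m + 1)) := by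
      rw [hsize m hm.1, hsize m' hm'.1, (List.cons.inj h).1]
    rcases lt_or_gt_of_ne hne with h4 | h4
    · have := hlt _ _ h4 hm'.1; omega
    · have := hlt _ _ h4 hm.1; omega

lemma S_eq_blockSum (α : Comp) : S α = blockSum weight α := by
  induction h : α.length using Nat.strong_induction_on generalizing α with
  | _ n ih =>
    subst h
    by_cases hα : α = []
    · rw [hα, S_nil, blockSum_nil]
    · rw [S_eq hα, blockSum_eq _ hα]
      refine Finset.sum_congr rfl fun m hm => ?_
      rw [Finset.mem_range] at hm
      rw [ih _ _ _ rfl]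
      rw [List.length_drop]; omega

end QSym

end

theorem mainTheorem12 (α : Comp) :
    HopfAlgebra.antipode ℂ (QSym.S α) = (-1 : ℂ) ^ α.length • QSym.S α.reverse := by
  rw [QSym.S_eq_blockSum, QSym.S_eq_blockSum, QSym.antipode_blockSum_weight]
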